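/- **Model.** In the coordinator model, $k$ players, each holding a private input, communicate with a coordinator who has no input. There is a private channel between the coordinator and each player, and no channel between players. All parties have independent private coins (arbitrary probability spaces). Messages are self-delimiting: whether it is player $i$'s turn to speak is determined by the bits exchanged so far on channel $i$. Whenever the coordinator is not waiting for a player, it either sends a bit to a player of its choice or ends the protocol by outputting an answer, depending on its coins and on everything it has seen; what a player sends depends on its coins, its input and the bits on its own channel. The communication complexity $\mathrm{CC}(\Pi)\in\mathbb N\cup\{\infty\}$ of a protocol $\Pi$ is the maximum, over all inputs and all outcomes of the coins, of the total number of bits exchanged on all channels. $\Pi$ solves a problem with error at most $\delta$ if, on every admissible input, the probability over the coins that the coordinator does not output a correct answer is at most $\delta$; the $\delta$-error communication complexity $\mathrm{CC}_\delta$ of a problem is the minimum of $\mathrm{CC}(\Pi)$ over all such $\Pi$. We say that $\Pi$ *ends recognizably* if every player who has been contacted can tell from its channel when its conversation is over, that is, if on no channel a nonempty complete conversation is a proper prefix of another complete conversation on that channel (over all inputs and coins). **Problems.** In Set Disjointness $\mathrm{Disj}_{n,k}$ player $i$ receives $X^i\subseteq[n]$ and the coordinator has to decide whether $\bigcap_{i=1}^k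 X^i\neq\emptyset$. In (Promise) Task Allocation $\mathrm{TaskAlloc}_{n,k}$ player $i$ receives $X^i\subseteq[n]$, with the promise that $\bigcup_{i=1}^k X^i=[n]$, and the coordinator has to output an assignment $Y:[n]\to[k]$ with $j\in X^{Y(j)}$ for every $j\in[n]$. **Theorem.** 1. There is a constant $K>0$ such that for all $n,k\in\mathbb N$ and all $\delta\ge 0$: for every protocol $P$ that ends recognizably and solves $\mathrm{TaskAlloc}_{n,k}$ with error at most $\delta$, there is a protocol $Q$ that ends recognizably, solves $\mathrm{Disj}_{n,k}$ with error at most $\delta$, and satisfies $$\mathrm{CC}(Q)\le \mathrm{CC}(P)+K\,(n\log n+k).$$ 2. For every $\delta\in[0,1)$ there are $c>0$, $a_0>0$ and $n_0$ such that for all $a\ge a_0$, all $n\ge n_0$ and all $k\ge a\log n$, $$\mathrm{CC}_\delta(\mathrm{TaskAlloc}_{n,k})\ge c\,nk,$$ where the minimum in $\mathrm{CC}_\delta$ is over all protocols, whether or not they end recognizably. -/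

import Mathlib

open MeasureTheory
open scoped ENNReal

namespace Coordinator

/-- The bits exchanged so far in an execution with `k` players and a coordinator, in chronological
order. The entry `(i, b)` means that the bit `b` was sent on the private channel between player `i`
and the coordinator; whether it was sent by the player or by the coordinator is determined by the
earlier bits on that channel (see `Protocol.playerTurn`). -/
abbrev Transcript (k : ℕ) : Type := List (Fin k × Bool)

/-- The bits that were exchanged on the channel of player `i`; this is all that player `i` sees. -/
def channel {k : ℕ} (i : Fin k) (τ : Transcript k) : List Bool :=
  (τ.filter (fun e => decide (e.1 = i))).map Prod.snd

/-- A private-coin protocol in the coordinator model with `k` players, inputs in `In` and outputs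
in `Out`. The coordinator has no input. Every party has its own probability space of coins.

Messages are self-delimiting: whether it is player `i`'s turn to speak is a function `playerTurn i`
of the bits exchanged so far on channel `i`. A message is completed when the turn on its channel
changes. When the coordinator is not waiting for a player, it either outputs an answer (and the
protocol ends) or sends a bit to a player of its choice, depending on its coins and on everything
it has seen. A player's bits depend on its coins, on its input and on the bits on its channel. -/
structure Protocol (k : ℕ) (In Out : Type) where
  CoordCoins : Type
  PlayerCoins : Fin k → Type
  [coordSpace : MeasurableSpace CoordCoins]
  [playerSpace : ∀ i, MeasurableSpace (PlayerCoins i)]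
  coordLaw : Measure CoordCoins
  playerLaw : ∀ i, Measure (PlayerCoins i)
  [coordProb : IsProbabilityMeasure coordLaw]
  [playerProb : ∀ i, IsProbabilityMeasure (playerLaw i)]
  playerTurn : Fin k → List Bool → Bool
  coord : CoordCoins → Transcript k → Out ⊕ (Fin k × Bool)
  player : ∀ i, PlayerCoins i → In → List Bool → Bool
  measurableSet_coord : ∀ τ a, MeasurableSet {r | coord r τ = a}
  measurableSet_player : ∀ i x h b, MeasurableSet {r | player i r x h = b}

attribute [instance] Protocol.coordSpace Protocol.playerSpace
  Protocol.coordProb Protocol.playerProb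

namespace Protocol

variable {k : ℕ} {In Out : Type}

/-- The outcomes of all the coins: those of the coordinator and those of each player. -/
abbrev Coins (P : Protocol k In Out) : Type := P.CoordCoins × (∀ i, P.PlayerCoins i)

/-- The coins of the different parties are independent. -/
noncomputable def law (P : Protocol k In Out) : Measure P.Coins :=
  P.coordLaw.prod (Measure.pi P.playerLaw)

/-- What happens after the transcript `τ`, on input `X` and coins `ρ`: an output of the coordinator
or one more bit on one channel. The execution is sequential, so that the only player who can be
due to speak is the one on whose channel the last bit was sent. -/
def next (P : Protocol k In Out) (X : Fin k → In) (ρ : P.Coins) (τ : Transcript k) :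
    Out ⊕ (Fin k × Bool) :=
  match τ.getLast? with
  | none => P.coord ρ.1 τ
  | some (i, _) =>
      if P.playerTurn i (channel i τ) = true then
        Sum.inr (i, P.player i (ρ.2 i) (X i) (channel i τ))
      else P.coord ρ.1 τ

/-- The transcript after `m` steps; it does not change any more once the coordinator has given
its output. -/
def exec (P : Protocol k In Out) (X : Fin k → In) (ρ : P.Coins) : ℕ → Transcript k
  | 0 => []
  | m + 1 =>
      match P.next X ρ (P.exec X ρ m) with
      | Sum.inl _ => P.exec X ρ m
      | Sum.inr e => P.exec X ρ m ++ [e]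

/-- On input `X` and coins `ρ` the protocol ends with the complete transcript `τ`, and the
coordinator outputs `y`. -/
def Ends (P : Protocol k In Out) (X : Fin k → In) (ρ : P.Coins) (τ : Transcript k) (y : Out) :
    Prop :=
  (∃ m, P.exec X ρ m = τ) ∧ P.next X ρ τ = Sum.inl y

/-- The communication complexity of a protocol: the maximum, over all inputs and all outcomes of
the coins, of the total number of bits exchanged on all channels (infinite if unbounded). -/
noncomputable def cost (P : Protocol k In Out) : ℕ∞ :=
  ⨆ (X : Fin k → In) (ρ : P.Coins) (m : ℕ), ((P.exec X ρ m).length : ℕ∞)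

/-- Every player who has been contacted can tell from its channel when its conversation with the
coordinator is over: a nonempty complete conversation on a channel is never a proper prefix of
another complete conversation on that channel. -/
def EndsRecognizably (P : Protocol k In Out) : Prop :=
  ∀ (i : Fin k) (X X' : Fin k → In) (ρ ρ' : P.Coins) (τ τ' : Transcript k) (y y' : Out),
    P.Ends X ρ τ y → P.Ends X' ρ' τ' y' →
      channel i τ ≠ [] → channel i τ <+: channel i τ' → channel i τ = channel i τ'

end Protocol

/-- A communication problem with `k` players: the admissible inputs, and which outputs are correct
on an input. -/
structure Problem (k : ℕ) (In Out : Type) where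
  promise : (Fin k → In) → Prop
  correct : (Fin k → In) → Out → Prop

/-- On every input that satisfies the promise, the probability over the private coins that the
coordinator does not output a correct answer is at most `δ`. -/
def Protocol.Solves {k : ℕ} {In Out : Type} (P : Protocol k In Out) (Q : Problem k In Out)
    (δ : ℝ) : Prop :=
  ∀ X, Q.promise X →
    P.law {ρ | ¬ ∃ τ y, P.Ends X ρ τ y ∧ Q.correct X y} ≤ ENNReal.ofReal δ

/-- The `δ`-error randomized communication complexity of a problem in the coordinator model. -/
noncomputable def Problem.cc {k : ℕ} {In Out : Type} (Q : Problem k In Out) (δ : ℝ) : ℕ∞ :=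
  ⨅ (P : Protocol k In Out) (_ : P.Solves Q δ), P.cost

/-- Set Disjointness: decide whether some element of `[n]` belongs to all the sets. -/
def setDisjointness (n k : ℕ) : Problem k (Finset (Fin n)) Bool where
  promise _ := True
  correct X y := y = true ↔ ∃ j, ∀ i, j ∈ X i

/-- Task Allocation: under the promise that every task can be performed by some player, assign
every task to a player who can perform it. -/
def taskAllocation (n k : ℕ) : Problem k (Finset (Fin n)) (Fin n → Fin k) where
  promise X := ∀ j, ∃ i, j ∈ X i
  correct X Y := ∀ j, j ∈ X (Y j)

end Coordinator

/-! ### Transcripts, executions, and cut and paste -/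

namespace Coordinator

variable {k : ℕ} {In Out : Type}

/-! Lower bound. The coins are fixed first and averaged out at the end, so the execution is a
function of the input. The columns (tasks) of the input are independent; each has a uniformly random
owner `Z l`, and besides the owner it is empty with probability 1/4 and otherwise filled with
independent bits of mean 1/3. In one column `j` everything but the owner is erased, so a correct
answer must name `Z j`. If the cost is a small multiple of `n * k`, an average player exchanges few
bits compared with `n`, and for most `j` it cannot signal that it belongs to column `j`. Adding a
second random player `i` to that column therefore hardly changes the answer. But now `i` and `Z j`
are exchangeable, so the owner is named about as often as `i`; and `i` is named about as often as
without being added, which has probability at most `1 / k` (`sum_expect_hardMean_le`).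

The small influence of one player (`sum_abs_hardMean_setCol_le`) is a two-party disjointness
argument between player `i` and all the others. By cut and paste (`Protocol.exec_update`) the
conversation `u` on channel `i` has probability `a u x * b u m`, where `x` is the row of the player
and `m` marks the columns erased for the others. Given a random set `c` of columns, `x` is supported
on `c` and `m` off `c`, so the pair (1, 1) never occurs in a column. Nevertheless the product form
bounds the change from (0, 1) to (1, 1) by the changes from (0, 0) to (1, 0) and to (0, 1)
(`abs_sub_mul_le`). These are Fourier coefficients of degree one; the level-one inequality bounds
them by the entropy of the conversation, hence by its expected length (`expect_sum_advantage_le`).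

Reduction. Run `P` on the complements of the sets. If the sets have no common element, the
complements cover everything, and a correct assignment gives each task to a player whose set does
not contain it; a common element refutes every assignment. So the coordinator sends each player the
list of its tasks and receives one bit of verification, at a cost of order `n log n + k`. The
delicate point is that a player must see from its channel alone that `P` is over. Recognizable ends
settle this for players that `P` contacts, and a bit sent before the first use of a channel
(`Protocol.flag`) distinguishes them from the others. Then every channel parses uniquely
(`Protocol.IsFlagged.request_unique`), and `Protocol.thenQuery` appends the queries to `P`. -/

@[simp] theorem channel_nil (i : Fin k) : channel i ([] : Transcript k) = [] := rfl

theorem channel_append (i : Fin k) (τ σ : Transcript k) :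
    channel i (τ ++ σ) = channel i τ ++ channel i σ := by
  simp [channel]

theorem channel_snoc (i : Fin k) (τ : Transcript k) (e : Fin k × Bool) :
    channel i (τ ++ [e]) = channel i τ ++ if e.1 = i then [e.2] else [] := by
  rw [channel_append]
  by_cases h : e.1 = i <;> simp [channel, h]

theorem channel_map_mk (i i' : Fin k) (w : List Bool) :
    channel i (w.map (fun b => (i', b))) = if i' = i then w else [] := by
  induction w with
  | nil => simp
  | cons b w ih =>
    rw [List.map_cons, ← List.singleton_append, channel_append, ih]
    by_cases h : i' = i <;> simp [channel, h]

theorem sum_length_channel (τ : Transcript k) : ∑ i, (channel i τ).length = τ.length := by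
  induction τ using List.reverseRecOn with
  | nil => simp
  | append_singleton τ e ih =>
    simp only [channel_snoc, List.length_append, Finset.sum_add_distrib, ih]
    simp [apply_ite List.length]

namespace Protocol

variable (P : Protocol k In Out) {X X' : Fin k → In} {ρ ρ' : P.Coins} {τ τ' : Transcript k}
  {y y' : Out} {m m' : ℕ}

/-- After the transcript `τ` some player is due to speak. -/
def dueTurn (τ : Transcript k) : Prop :=
  ∃ i b, τ.getLast? = some (i, b) ∧ P.playerTurn i (channel i τ) = true

theorem next_of_turn {i : Fin k} {b : Bool} (h : τ.getLast? = some (i, b))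
    (ht : P.playerTurn i (channel i τ) = true) :
    P.next X ρ τ = Sum.inr (i, P.player i (ρ.2 i) (X i) (channel i τ)) := by
  simp [next, h, ht]

theorem next_of_not_dueTurn (h : ¬ P.dueTurn τ) : P.next X ρ τ = P.coord ρ.1 τ := by
  unfold next
  split
  · rfl
  · rename_i i b hl
    rw [if_neg]
    exact fun ht => h ⟨i, b, hl, ht⟩

theorem next_eq_inl_iff :
    P.next X ρ τ = Sum.inl y ↔ ¬ P.dueTurn τ ∧ P.coord ρ.1 τ = Sum.inl y := by
  by_cases h : P.dueTurn τ
  · obtain ⟨i, b, hl, ht⟩ := id h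
    simp [P.next_of_turn hl ht, h]
  · simp [P.next_of_not_dueTurn h, h]

theorem exec_succ_of_inr {e : Fin k × Bool} (h : P.next X ρ (P.exec X ρ m) = Sum.inr e) :
    P.exec X ρ (m + 1) = P.exec X ρ m ++ [e] := by
  simp [exec, h]

theorem exec_succ_of_inl (h : P.next X ρ (P.exec X ρ m) = Sum.inl y) :
    P.exec X ρ (m + 1) = P.exec X ρ m := by
  simp [exec, h]

theorem exec_succ_cases (X : Fin k → In) (ρ : P.Coins) (m : ℕ) :
    (∃ y, P.next X ρ (P.exec X ρ m) = Sum.inl y ∧ P.exec X ρ (m + 1) = P.exec X ρ m) ∨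
    ∃ e, P.next X ρ (P.exec X ρ m) = Sum.inr e ∧ P.exec X ρ (m + 1) = P.exec X ρ m ++ [e] := by
  rcases h : P.next X ρ (P.exec X ρ m) with y | e
  · exact Or.inl ⟨y, rfl, P.exec_succ_of_inl h⟩
  · exact Or.inr ⟨e, rfl, P.exec_succ_of_inr h⟩

theorem exec_prefix_succ (X : Fin k → In) (ρ : P.Coins) (m : ℕ) :
    P.exec X ρ m <+: P.exec X ρ (m + 1) := by
  rcases P.exec_succ_cases X ρ m with ⟨y, -, h⟩ | ⟨e, -, h⟩ <;> rw [h]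
  exact List.prefix_append _ _

theorem exec_prefix (X : Fin k → In) (ρ : P.Coins) (h : m ≤ m') :
    P.exec X ρ m <+: P.exec X ρ m' := by
  induction h with
  | refl => exact List.prefix_refl _
  | step _ ih => exact ih.trans (P.exec_prefix_succ X ρ _)

theorem exec_eq_of_inl (h : P.next X ρ (P.exec X ρ m) = Sum.inl y) (hm : m ≤ m') :
    P.exec X ρ m' = P.exec X ρ m := by
  induction hm with
  | refl => rfl
  | step _ ih =>
    rw [← ih] at h
    rw [← ih, P.exec_succ_of_inl h]

theorem Ends.exec_prefix {P : Protocol k In Out} {X : Fin k → In} {ρ : P.Coins}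
    (h : P.Ends X ρ τ y) (m : ℕ) : P.exec X ρ m <+: τ := by
  obtain ⟨⟨m', rfl⟩, h⟩ := h
  rcases le_total m m' with hm | hm
  · exact P.exec_prefix X ρ hm
  · rw [P.exec_eq_of_inl h hm]

theorem Ends.unique {P : Protocol k In Out} {X : Fin k → In} {ρ : P.Coins}
    (h : P.Ends X ρ τ y) (h' : P.Ends X ρ τ' y') : τ = τ' ∧ y = y' := by
  have h₁ : τ = τ' := by
    obtain ⟨m, hm⟩ := h.1
    obtain ⟨m', hm'⟩ := h'.1
    have a := h'.exec_prefix m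
    have b := h.exec_prefix m'
    rw [hm] at a
    rw [hm'] at b
    exact a.eq_of_length_le b.length_le
  subst h₁
  exact ⟨rfl, Sum.inl.inj (h.2.symm.trans h'.2)⟩

/-- An execution in which every step so far was productive has as many bits as steps. -/
theorem length_exec_or (X : Fin k → In) (ρ : P.Coins) (m : ℕ) :
    (P.exec X ρ m).length = m ∨ ∃ y, P.Ends X ρ (P.exec X ρ m) y := by
  induction m with
  | zero => exact Or.inl rfl
  | succ m ih =>
    rcases P.exec_succ_cases X ρ m with ⟨y, hy, h⟩ | ⟨e, he, h⟩
    · exact Or.inr ⟨y, ⟨m + 1, rfl⟩, by rw [h, hy]⟩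
    · rcases ih with ih | ⟨y, hy⟩
      · left; rw [h]; simp [ih]
      · rw [hy.2] at he; simp at he

theorem length_exec_le_cost (X : Fin k → In) (ρ : P.Coins) (m : ℕ) :
    ((P.exec X ρ m).length : ℕ∞) ≤ P.cost :=
  le_iSup_of_le X (le_iSup_of_le ρ (le_iSup (fun m => ((P.exec X ρ m).length : ℕ∞)) m))

/-- Every step before the end adds a bit, so `C + 1` such steps would exceed the cost. -/
theorem exists_ends {C : ℕ} (hC : P.cost ≤ C) (X : Fin k → In) (ρ : P.Coins) :
    ∃ y, P.Ends X ρ (P.exec X ρ (C + 1)) y := by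
  rcases P.length_exec_or X ρ (C + 1) with h | h
  · have := (P.length_exec_le_cost X ρ (C + 1)).trans hC
    rw [h] at this
    have := Nat.cast_le.1 this
    omega
  · exact h

/-- A player whose turn it is on its channel was the last to be on a channel. -/
theorem getLast_of_playerTurn (X : Fin k → In) (ρ : P.Coins) (m : ℕ) (i : Fin k)
    (hne : channel i (P.exec X ρ m) ≠ [])
    (ht : P.playerTurn i (channel i (P.exec X ρ m)) = true) :
    ∃ b, (P.exec X ρ m).getLast? = some (i, b) := by
  induction m with
  | zero => simp [exec] at hne
  | succ m ih =>
    rcases P.exec_succ_cases X ρ m with ⟨y, -, h⟩ | ⟨e, he, h⟩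
    · rw [h] at hne ht ⊢; exact ih hne ht
    · rw [h] at hne ht ⊢
      by_cases hi : e.1 = i
      · exact ⟨e.2, by simp [← hi]⟩
      -- The turn on channel `i` was then pending before this step, which forces the step itself
      -- onto channel `i`.
      · rw [channel_snoc, if_neg hi, List.append_nil] at hne ht
        obtain ⟨b, hb⟩ := ih hne ht
        rw [P.next_of_turn hb ht] at he
        simp only [Sum.inr.injEq] at he
        exact absurd (by rw [← he]) hi

/-- The bits that player `i` has sent are determined by its coins, its input and its channel. -/
theorem eq_player_of_prefix (X : Fin k → In) (ρ : P.Coins) (m : ℕ) (i : Fin k) {h : List Bool}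
    {b : Bool} (hne : h ≠ []) (hp : h ++ [b] <+: channel i (P.exec X ρ m))
    (ht : P.playerTurn i h = true) : b = P.player i (ρ.2 i) (X i) h := by
  induction m with
  | zero => simp [exec] at hp
  | succ m ih =>
    rcases P.exec_succ_cases X ρ m with ⟨y, -, hm⟩ | ⟨e, he, hm⟩
    · rw [hm] at hp; exact ih hp
    · rw [hm, channel_snoc] at hp
      split_ifs at hp with hi
      · rcases List.prefix_concat_iff.1 hp with hp | hp
        · obtain ⟨hh, hb⟩ := List.append_inj' hp rfl
          subst hh
          obtain ⟨b', hb'⟩ := P.getLast_of_playerTurn X ρ m i hne ht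
          rw [P.next_of_turn hb' ht] at he
          simp only [Sum.inr.injEq] at he
          rw [← he] at hb
          simpa using hb
        · exact ih hp
      · rw [List.append_nil] at hp; exact ih hp

/-- Cut and paste: if two executions look the same on channel `i`, then the input of player `i`
in one of them can be replaced by that in the other. -/
theorem exec_update (X X' : Fin k → In) (ρ : P.Coins) (N : ℕ) (i : Fin k)
    (h : channel i (P.exec X ρ N) = channel i (P.exec X' ρ N)) {m : ℕ} (hm : m ≤ N) :
    P.exec (Function.update X' i (X i)) ρ m = P.exec X' ρ m := by
  induction m with
  | zero => rfl
  | succ m ih =>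
    have ih := ih (by omega)
    have key : P.next (Function.update X' i (X i)) ρ (P.exec X' ρ m) =
        P.next X' ρ (P.exec X' ρ m) := by
      by_cases hd : P.dueTurn (P.exec X' ρ m)
      · obtain ⟨i', b, hl, ht⟩ := hd
        have hn := P.next_of_turn (X := X') (ρ := ρ) hl ht
        rw [P.next_of_turn hl ht, hn]
        -- Only a bit sent by player `i` depends on the replaced input. It is recorded on channel
        -- `i`, where the execution on `X` shows the same bit in response to the same history.
        by_cases hi : i' = i
        · subst hi
          have hne : channel i' (P.exec X' ρ m) ≠ [] := by
            obtain ⟨l, hl'⟩ : ∃ l, P.exec X' ρ m = l ++ [(i', b)] := by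
              obtain ⟨h1, h2⟩ := List.mem_getLast?_eq_getLast hl
              exact ⟨_, by rw [h2]; exact (List.dropLast_append_getLast h1).symm⟩
            rw [hl', channel_snoc]; simp
          have hs := P.exec_succ_of_inr hn
          have hp := P.exec_prefix X' ρ hm
          rw [hs] at hp
          obtain ⟨l, hl'⟩ := hp
          have : channel i' (P.exec X' ρ m) ++
              [P.player i' (ρ.2 i') (X' i') (channel i' (P.exec X' ρ m))] <+:
              channel i' (P.exec X ρ N) := by
            rw [h, ← hl', channel_append, channel_snoc]
            simp
          rw [P.eq_player_of_prefix X ρ N i' hne this ht]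
          simp
        · simp [Function.update_of_ne hi]
      · rw [P.next_of_not_dueTurn hd, P.next_of_not_dueTurn hd]
    simp only [exec, ih, key]

end Protocol

/-! ### Level-one inequality and the two-party disjointness bound -/

section Cube

open scoped BigOperators

variable {ι : Type*} [Fintype ι] [DecidableEq ι]

/-- The character of `{true, false}` with value `1` at `true` and `-1` at `false`. -/
def boolSign (b : Bool) : ℝ := if b then 1 else -1

theorem expect_cube_eq (f : (ι → Bool) → ℝ) (j : ι) :
    𝔼 e, f e =
      (𝔼 e, f (Function.update e j true) + 𝔼 e, f (Function.update e j false)) / 2 := by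
  have hinv : Function.Involutive (fun e : ι → Bool => Function.update e j (!e j)) := by
    intro e; simp
  have h₁ : 𝔼 e, f (Function.update e j (!e j)) = 𝔼 e, f e :=
    Fintype.expect_equiv hinv.toPerm _ _ (fun e => rfl)
  have h₂ : 𝔼 e, f (Function.update e j true) + 𝔼 e, f (Function.update e j false) =
      𝔼 e, f e + 𝔼 e, f (Function.update e j (!e j)) := by
    rw [← Finset.expect_add_distrib, ← Finset.expect_add_distrib]
    refine Finset.expect_congr rfl fun e _ => ?_
    rcases h : e j with _ | _
    · have : Function.update e j false = e := by rw [← h]; simp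
      rw [this, Bool.not_false, add_comm]
    · have : Function.update e j true = e := by rw [← h]; simp
      rw [this, Bool.not_true]
  rw [h₂, h₁]; ring

theorem expect_cube_mul_boolSign (f : (ι → Bool) → ℝ) (j : ι) :
    𝔼 e, f e * boolSign (e j) =
      (𝔼 e, f (Function.update e j true) - 𝔼 e, f (Function.update e j false)) / 2 := by
  rw [expect_cube_eq _ j]
  simp [boolSign, Finset.expect_neg_distrib, sub_eq_add_neg]

/-- The signs are independent, so the exponential moment is a product of hyperbolic cosines, and
`cosh t ≤ exp (t ^ 2 / 2)`. -/
theorem expect_exp_sum_boolSign_le (b : ι → ℝ) :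
    𝔼 e : ι → Bool, Real.exp (∑ j, b j * boolSign (e j)) ≤ Real.exp ((∑ j, b j ^ 2) / 2) := by
  have h₁ : 𝔼 e : ι → Bool, Real.exp (∑ j, b j * boolSign (e j)) = ∏ j, Real.cosh (b j) := by
    have : ∏ j, ∑ s : Bool, Real.exp (b j * boolSign s) =
        ∑ e : ι → Bool, ∏ j, Real.exp (b j * boolSign (e j)) := by
      rw [Finset.prod_univ_sum, Fintype.piFinset_univ]
    rw [Fintype.expect_eq_sum_div_card]
    simp only [Real.exp_sum]
    rw [← this]
    simp only [Fintype.card_pi, Fintype.card_bool, Fintype.univ_bool, Finset.prod_const]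
    push_cast
    rw [← Finset.prod_const, ← Finset.prod_div_distrib]
    refine Finset.prod_congr rfl fun j _ => ?_
    rw [Finset.sum_pair (by decide), Real.cosh_eq]
    simp [boolSign]
  rw [h₁, Finset.sum_div, Real.exp_sum]
  exact Finset.prod_le_prod (fun j _ => (Real.cosh_pos _).le)
    fun j _ => Real.cosh_le_exp_half_sq _

/-- The level-one inequality. -/
theorem sum_sq_expect_mul_boolSign_le (f : (ι → Bool) → ℝ) (h0 : ∀ e, 0 ≤ f e)
    (h1 : ∀ e, f e ≤ 1) (hpos : 0 < 𝔼 e, f e) :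
    ∑ j, (𝔼 e, f e * boolSign (e j)) ^ 2 ≤ (𝔼 e, f e) ^ 2 * (-2 * Real.log (𝔼 e, f e)) := by
  set μ := 𝔼 e, f e with hμ
  set d : ι → ℝ := fun j => 𝔼 e, f e * boolSign (e j) with hd
  set b : ι → ℝ := fun j => d j / μ with hb
  set S := ∑ j, b j ^ 2 with hS
  have hdb : ∀ j, d j = μ * b j := fun j => by simp only [hb]; field_simp
  have hg : 𝔼 e, f e * ∑ j, b j * boolSign (e j) = μ * S := by
    simp only [Finset.mul_sum]
    rw [Finset.expect_sum_comm, hS, Finset.mul_sum]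
    refine Finset.sum_congr rfl fun j _ => ?_
    have : 𝔼 e, f e * (b j * boolSign (e j)) = b j * d j := by
      rw [hd, Finset.mul_expect]
      exact Finset.expect_congr rfl fun e _ => by ring
    rw [this, hdb]; ring
  -- The linear form `∑ j, b j * boolSign (e j)` has mean `S` under the density `f / μ`. Bounding
  -- the exponential below by its tangent at `S` and `f` above by 1 compares `exp S * μ` with the
  -- full exponential moment.
  have key : Real.exp S * μ ≤ Real.exp (S / 2) := by
    calc Real.exp S * μ
        = 𝔼 e, f e * (Real.exp S * (1 + (∑ j, b j * boolSign (e j) - S))) := by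
          have : ∀ e, f e * (Real.exp S * (1 + (∑ j, b j * boolSign (e j) - S))) =
              Real.exp S * (f e * ∑ j, b j * boolSign (e j)) +
                (Real.exp S * (1 - S)) * f e := fun e => by ring
          simp only [this]
          rw [Finset.expect_add_distrib, ← Finset.mul_expect, ← Finset.mul_expect, hg, ← hμ]
          ring
      _ ≤ 𝔼 e : ι → Bool, Real.exp (∑ j, b j * boolSign (e j)) := by
          refine Finset.expect_le_expect fun e _ => ?_
          have h2 : Real.exp S * (1 + (∑ j, b j * boolSign (e j) - S)) ≤
              Real.exp (∑ j, b j * boolSign (e j)) := by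
            have := Real.add_one_le_exp (∑ j, b j * boolSign (e j) - S)
            calc _ ≤ Real.exp S * Real.exp (∑ j, b j * boolSign (e j) - S) := by
                  gcongr; linarith
              _ = _ := by rw [← Real.exp_add]; congr 1; ring
          calc _ ≤ f e * Real.exp (∑ j, b j * boolSign (e j)) :=
                mul_le_mul_of_nonneg_left h2 (h0 e)
            _ ≤ 1 * Real.exp (∑ j, b j * boolSign (e j)) := by gcongr; exact h1 e
            _ = _ := one_mul _
      _ ≤ _ := expect_exp_sum_boolSign_le b
  have hlog : S ≤ -2 * Real.log μ := by
    have := Real.log_le_log (by positivity) key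
    rw [Real.log_mul (by positivity) hpos.ne', Real.log_exp, Real.log_exp] at this
    linarith
  calc ∑ j, d j ^ 2 = μ ^ 2 * S := by
        rw [hS, Finset.mul_sum]
        exact Finset.sum_congr rfl fun j _ => by rw [hdb]; ring
    _ ≤ _ := by gcongr

/-- Apply `t ≤ η * μ / 2 + t ^ 2 / (2 * η * μ)` to each coefficient and the level-one inequality to
the sum of squares. The free parameter `η` later balances `n` against the communication. -/
theorem sum_abs_expect_mul_boolSign_le (f : (ι → Bool) → ℝ) (h0 : ∀ e, 0 ≤ f e)
    (h1 : ∀ e, f e ≤ 1) {η : ℝ} (hη : 0 < η) :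
    ∑ j, |𝔼 e, f e * boolSign (e j)| ≤
      Fintype.card ι * (η / 2) * (𝔼 e, f e) + (𝔼 e, f e) * -Real.log (𝔼 e, f e) / η := by
  rcases (Finset.expect_nonneg (s := Finset.univ) fun e _ => h0 e).eq_or_lt with h | hpos
  · have hz : ∀ e, f e = 0 := by
      have := (Fintype.expect_eq_zero_iff_of_nonneg (f := f) h0).1 h.symm
      exact fun e => congrFun this e
    simp [hz]
  · set μ := 𝔼 e, f e with hμ
    have hj : ∀ j, |𝔼 e, f e * boolSign (e j)| ≤
        η / 2 * μ + (𝔼 e, f e * boolSign (e j)) ^ 2 / (2 * η * μ) := by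
      intro j
      rw [← sq_abs (𝔼 e, f e * boolSign (e j))]
      set t := |𝔼 e, f e * boolSign (e j)|
      rw [← sub_nonneg]
      have : η / 2 * μ + t ^ 2 / (2 * η * μ) - t = (η * μ - t) ^ 2 / (2 * η * μ) := by
        field_simp; ring
      rw [this]; positivity
    calc _ ≤ ∑ j, (η / 2 * μ + (𝔼 e, f e * boolSign (e j)) ^ 2 / (2 * η * μ)) :=
          Finset.sum_le_sum fun j _ => hj j
      _ = Fintype.card ι * (η / 2) * μ +
            (∑ j, (𝔼 e, f e * boolSign (e j)) ^ 2) / (2 * η * μ) := by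
          rw [Finset.sum_add_distrib, Finset.sum_div]; simp; ring
      _ ≤ Fintype.card ι * (η / 2) * μ + μ ^ 2 * (-2 * Real.log μ) / (2 * η * μ) := by
          gcongr; exact sum_sq_expect_mul_boolSign_le f h0 h1 hpos
      _ = _ := by field_simp

/-- If `b₁ ≤ 3 * b₀`, twice the left side is at most `6 * (|a₁ - a₀| * b₀)`, which pays for the
sign. Otherwise the negative part of `a₁ - a₀` is at most `a₀`, and `b₁` is at most `3 / 2` times
`|b₁ - b₀|`. The signed term is kept because it cancels when summed over all conversations. -/
theorem abs_sub_mul_le {a₀ a₁ b₀ b₁ : ℝ} (ha₀ : 0 ≤ a₀) (ha₁ : 0 ≤ a₁) (hb₀ : 0 ≤ b₀)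
    (hb₁ : 0 ≤ b₁) :
    |a₁ - a₀| * b₁ ≤ (a₁ - a₀) * b₁ + 6 * (|a₁ - a₀| * b₀) + 3 * (a₀ * |b₁ - b₀|) := by
  have hA := abs_nonneg (a₁ - a₀)
  have hA' := neg_abs_le (a₁ - a₀)
  by_cases h : b₁ ≤ 3 * b₀
  · nlinarith [mul_nonneg hA (sub_nonneg.2 h), mul_nonneg ha₀ (abs_nonneg (b₁ - b₀)),
      mul_nonneg hb₁ (by linarith : 0 ≤ (a₁ - a₀) + |a₁ - a₀|)]
  · have hb : |b₁ - b₀| = b₁ - b₀ := abs_of_nonneg (by linarith)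
    have h3 : |a₁ - a₀| ≤ a₁ - a₀ + 2 * a₀ := by
      rw [abs_le]; constructor <;> linarith
    rw [hb]
    nlinarith [mul_le_mul_of_nonneg_right h3 hb₁, mul_nonneg hA hb₀,
      mul_nonneg ha₀ (by linarith : 0 ≤ b₁ - 3 * b₀)]

/-- As `F` ignores coordinate `j`, one may condition on the value of that coordinate; the factor 2
is the inverse of its probability. -/
theorem expect_eq_expect_ite {F : (ι → Bool) → ℝ} (j : ι)
    (hF : ∀ c v, F (Function.update c j v) = F c) (s : Bool) :
    𝔼 c, F c = 𝔼 c, if c j = s then 2 * F c else 0 := by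
  rw [expect_cube_eq (fun c : ι → Bool => if c j = s then 2 * F c else 0) j]
  simp only [Function.update_self, hF]
  cases s <;> simp [← Finset.mul_expect]

section

variable {ι : Type*} [DecidableEq ι]

/-- The inputs of Alice that are supported on `c`. -/
def onSet (c e : ι → Bool) : ι → Bool := fun l => c l && e l

/-- The inputs of Bob that are supported off `c`. -/
def offSet (c e : ι → Bool) : ι → Bool := fun l => !c l && e l

theorem onSet_update {c : ι → Bool} {j : ι} (hj : c j = true) (e : ι → Bool) (v : Bool) :
    onSet c (Function.update e j v) = Function.update (onSet c e) j v := by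
  funext l
  by_cases h : l = j
  · subst h; simp [onSet, hj]
  · simp [onSet, h]

theorem offSet_update {c : ι → Bool} {j : ι} (hj : c j = false) (e : ι → Bool) (v : Bool) :
    offSet c (Function.update e j v) = Function.update (offSet c e) j v := by
  funext l
  by_cases h : l = j
  · subst h; simp [offSet, hj]
  · simp [offSet, h]

theorem update_onSet_update (c e : ι → Bool) (j : ι) (v w : Bool) :
    Function.update (onSet (Function.update c j w) e) j v = Function.update (onSet c e) j v := by
  funext l
  by_cases h : l = j
  · subst h; simp
  · simp [onSet, h]

theorem update_offSet_update (c e : ι → Bool) (j : ι) (v w : Bool) :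
    Function.update (offSet (Function.update c j w) e) j v =
      Function.update (offSet c e) j v := by
  funext l
  by_cases h : l = j
  · subst h; simp
  · simp [offSet, h]

theorem onSet_eq_update {c : ι → Bool} {j : ι} (hj : c j = false) (e : ι → Bool) :
    Function.update (onSet c e) j false = onSet c e := by
  rw [Function.update_eq_self_iff]; simp [onSet, hj]

theorem offSet_eq_update {c : ι → Bool} {j : ι} (hj : c j = true) (e : ι → Bool) :
    Function.update (offSet c e) j false = offSet c e := by
  rw [Function.update_eq_self_iff]; simp [offSet, hj]

end

variable {𝒰 : Type*} [Fintype 𝒰]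

/-- How well the conversation tells apart the values of the bit `j` of Alice when the bit `j` of
Bob is set, the other bits being random, supported on `c` for Alice and off `c` for Bob. -/
noncomputable def advantage (a b : 𝒰 → (ι → Bool) → ℝ) (c : ι → Bool) (j : ι) : ℝ :=
  ∑ u, |𝔼 e, a u (Function.update (onSet c e) j true) -
      𝔼 e, a u (Function.update (onSet c e) j false)| *
    𝔼 e, b u (Function.update (offSet c e) j true)

/-- Gibbs' inequality: entropy is at most the mean length in any code satisfying Kraft's inequality.
It follows from `log t ≤ t - 1` at `t = exp (-w u) / p u`. -/
theorem sum_mul_neg_log_le {p w : 𝒰 → ℝ} (hp : ∀ u, 0 ≤ p u) (hp1 : ∑ u, p u = 1)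
    (hw : ∑ u, Real.exp (-w u) ≤ 1) : ∑ u, p u * -Real.log (p u) ≤ ∑ u, p u * w u := by
  have h : ∀ u, p u * -Real.log (p u) ≤ p u * w u + (Real.exp (-w u) - p u) := by
    intro u
    rcases (hp u).eq_or_lt with h | h
    · rw [← h]; simp [(Real.exp_pos _).le]
    · have h1 := Real.log_le_sub_one_of_pos (div_pos (Real.exp_pos (-w u)) h)
      rw [Real.log_div (Real.exp_pos _).ne' h.ne', Real.log_exp] at h1
      have h2 := mul_le_mul_of_nonneg_left h1 h.le
      have h3 : p u * (Real.exp (-w u) / p u - 1) = Real.exp (-w u) - p u := by field_simp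
      rw [h3] at h2
      linarith
  calc _ ≤ ∑ u, (p u * w u + (Real.exp (-w u) - p u)) := Finset.sum_le_sum fun u _ => h u
    _ ≤ _ := by rw [Finset.sum_add_distrib, Finset.sum_sub_distrib, hp1]; linarith

/-- The right side involves only disjoint pairs of inputs, while the advantage compares inputs that
meet in `j` with inputs that do not. The product form transfers the bound from the former to the
latter. -/
theorem expect_sum_advantage_le (a b : 𝒰 → (ι → Bool) → ℝ) (w : 𝒰 → ℝ)
    (ha0 : ∀ u x, 0 ≤ a u x) (ha1 : ∀ u x, a u x ≤ 1)
    (hb0 : ∀ u x, 0 ≤ b u x) (hb1 : ∀ u x, b u x ≤ 1)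
    (hab : ∀ x m, ∑ u, a u x * b u m = 1) (hw : ∑ u, Real.exp (-w u) ≤ 1)
    {η : ℝ} (hη : 0 < η) :
    𝔼 c, ∑ j, advantage a b c j ≤
      36 * (Fintype.card ι * (η / 2) +
        (𝔼 c, ∑ u, (𝔼 e, a u (onSet c e)) * (𝔼 e, b u (offSet c e)) * w u) / η) := by
  set A : Bool → 𝒰 → (ι → Bool) → ι → ℝ :=
    fun v u c j => 𝔼 e, a u (Function.update (onSet c e) j v) with hA
  set B : Bool → 𝒰 → (ι → Bool) → ι → ℝ :=
    fun v u c j => 𝔼 e, b u (Function.update (offSet c e) j v) with hB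
  set A' : 𝒰 → (ι → Bool) → ℝ := fun u c => 𝔼 e, a u (onSet c e) with hA'
  set B' : 𝒰 → (ι → Bool) → ℝ := fun u c => 𝔼 e, b u (offSet c e) with hB'
  have hA0 : ∀ v u c j, 0 ≤ A v u c j := fun v u c j => Finset.expect_nonneg fun e _ => ha0 _ _
  have hB0 : ∀ v u c j, 0 ≤ B v u c j := fun v u c j => Finset.expect_nonneg fun e _ => hb0 _ _
  have hA'0 : ∀ u c, 0 ≤ A' u c := fun u c => Finset.expect_nonneg fun e _ => ha0 _ _
  have hB'0 : ∀ u c, 0 ≤ B' u c := fun u c => Finset.expect_nonneg fun e _ => hb0 _ _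
  have hA'1 : ∀ u c, A' u c ≤ 1 :=
    fun u c => Finset.expect_le Finset.univ_nonempty fun e _ => ha1 _ _
  have hB'1 : ∀ u c, B' u c ≤ 1 :=
    fun u c => Finset.expect_le Finset.univ_nonempty fun e _ => hb1 _ _
  have hone : ∀ x m : (ι → Bool) → ι → Bool,
      ∑ u, (𝔼 e, a u (x e)) * (𝔼 e, b u (m e)) = 1 := by
    intro x m
    have h1 : ∀ u, (𝔼 e, a u (x e)) * (𝔼 e, b u (m e)) = 𝔼 e, 𝔼 e', a u (x e) * b u (m e') := by
      intro u; rw [Finset.expect_mul]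
      exact Finset.expect_congr rfl fun e _ => by rw [Finset.mul_expect]
    simp only [h1]
    rw [← Finset.expect_sum_comm]
    have h2 : ∀ e, ∑ u, 𝔼 e', a u (x e) * b u (m e') = 1 := by
      intro e
      rw [← Finset.expect_sum_comm]
      simp [hab]
    simp [h2]
  set t₁ : (ι → Bool) → ι → ℝ := fun c j => ∑ u, |A true u c j - A false u c j| * B false u c j
    with ht₁
  set t₂ : (ι → Bool) → ι → ℝ := fun c j => ∑ u, A false u c j * |B true u c j - B false u c j|
    with ht₂
  have hadv : ∀ c j, advantage a b c j ≤ 6 * t₁ c j + 3 * t₂ c j := by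
    intro c j
    -- For either value of Alice's bit the products form a probability distribution on
    -- conversations, so the signed terms cancel.
    have h0 : ∑ u, (A true u c j - A false u c j) * B true u c j = 0 := by
      simp only [sub_mul, Finset.sum_sub_distrib]
      rw [hone _ _, hone _ _, sub_self]
    calc advantage a b c j ≤ ∑ u, ((A true u c j - A false u c j) * B true u c j +
          6 * (|A true u c j - A false u c j| * B false u c j) +
          3 * (A false u c j * |B true u c j - B false u c j|)) :=
          Finset.sum_le_sum fun u _ =>
            abs_sub_mul_le (hA0 _ _ _ _) (hA0 _ _ _ _) (hB0 _ _ _ _) (hB0 _ _ _ _)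
      _ = _ := by
          rw [Finset.sum_add_distrib, Finset.sum_add_distrib, h0, ← Finset.mul_sum,
            ← Finset.mul_sum, zero_add]
  have hAup : ∀ v u c j s, A v u (Function.update c j s) j = A v u c j := by
    intro v u c j s; simp only [hA, update_onSet_update]
  have hBup : ∀ v u c j s, B v u (Function.update c j s) j = B v u c j := by
    intro v u c j s; simp only [hB, update_offSet_update]
  -- Neither `t₁` nor `t₂` depends on `c j`. Choosing `c j = true` makes Alice's bit `j` random and
  -- Bob's zero, as `t₁` requires; `c j = false` does the same for `t₂` with the roles exchanged.
  have ht₁e : ∀ j, 𝔼 c, t₁ c j = 𝔼 c, if c j = true then 2 * t₁ c j else 0 := fun j =>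
    expect_eq_expect_ite (F := fun c => t₁ c j) j (fun c v => by simp only [ht₁, hAup, hBup]) true
  have ht₂e : ∀ j, 𝔼 c, t₂ c j = 𝔼 c, if c j = false then 2 * t₂ c j else 0 := fun j =>
    expect_eq_expect_ite (F := fun c => t₂ c j) j (fun c v => by simp only [ht₂, hAup, hBup]) false
  -- One factor 2 comes from conditioning on `c j`, the other from the difference being twice the
  -- Fourier coefficient.
  have hd₁ : ∀ c j, (if c j = true then 2 * t₁ c j else 0) ≤
      4 * ∑ u, B' u c * |𝔼 e, a u (onSet c e) * boolSign (e j)| := by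
    intro c j
    split_ifs with h
    · simp only [ht₁, Finset.mul_sum]
      refine Finset.sum_le_sum fun u _ => le_of_eq ?_
      rw [expect_cube_mul_boolSign (fun e => a u (onSet c e)) j]
      simp only [onSet_update h, hA, hB, hB', offSet_eq_update h, abs_div, abs_two]
      ring
    · exact mul_nonneg (by norm_num) (Finset.sum_nonneg fun u _ =>
        mul_nonneg (hB'0 _ _) (abs_nonneg _))
  have hd₂ : ∀ c j, (if c j = false then 2 * t₂ c j else 0) ≤
      4 * ∑ u, A' u c * |𝔼 e, b u (offSet c e) * boolSign (e j)| := by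
    intro c j
    split_ifs with h
    · simp only [ht₂, Finset.mul_sum]
      refine Finset.sum_le_sum fun u _ => le_of_eq ?_
      rw [expect_cube_mul_boolSign (fun e => b u (offSet c e)) j]
      simp only [offSet_update h, hA, hB, hA', onSet_eq_update h, abs_div, abs_two]
      ring
    · exact mul_nonneg (by norm_num) (Finset.sum_nonneg fun u _ =>
        mul_nonneg (hA'0 _ _) (abs_nonneg _))
  have hc : ∀ c, ∑ j, (24 * ∑ u, B' u c * |𝔼 e, a u (onSet c e) * boolSign (e j)| +
      12 * ∑ u, A' u c * |𝔼 e, b u (offSet c e) * boolSign (e j)|) ≤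
      36 * (Fintype.card ι * (η / 2) + (∑ u, A' u c * B' u c * w u) / η) := by
    intro c
    have hP0 : ∀ u, 0 ≤ A' u c * B' u c := fun u => mul_nonneg (hA'0 _ _) (hB'0 _ _)
    have hP1 : ∑ u, A' u c * B' u c = 1 := hone (fun e => onSet c e) (fun e => offSet c e)
    have hu : ∀ u, 24 * (B' u c * ∑ j, |𝔼 e, a u (onSet c e) * boolSign (e j)|) +
        12 * (A' u c * ∑ j, |𝔼 e, b u (offSet c e) * boolSign (e j)|) ≤
        36 * (Fintype.card ι * (η / 2) * (A' u c * B' u c) +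
          (A' u c * B' u c * -Real.log (A' u c * B' u c)) / η) := by
      intro u
      have e₁ := mul_le_mul_of_nonneg_left (sum_abs_expect_mul_boolSign_le
        (fun e => a u (onSet c e)) (fun e => ha0 _ _) (fun e => ha1 _ _) hη) (hB'0 u c)
      have e₂ := mul_le_mul_of_nonneg_left (sum_abs_expect_mul_boolSign_le
        (fun e => b u (offSet c e)) (fun e => hb0 _ _) (fun e => hb1 _ _) hη) (hA'0 u c)
      change _ ≤ B' u c * (_ * A' u c + A' u c * -Real.log (A' u c) / η) at e₁
      change _ ≤ A' u c * (_ * B' u c + B' u c * -Real.log (B' u c) / η) at e₂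
      have hl : A' u c * B' u c * -Real.log (A' u c * B' u c) =
          A' u c * B' u c * -Real.log (A' u c) + A' u c * B' u c * -Real.log (B' u c) := by
        rcases (hA'0 u c).eq_or_lt with h | h
        · rw [← h]; simp
        rcases (hB'0 u c).eq_or_lt with h' | h'
        · rw [← h']; simp
        rw [Real.log_mul h.ne' h'.ne']; ring
      -- Both entropy terms are nonnegative, so their coefficients 24 and 12 may be raised to the
      -- common value 36.
      have n₁ : 0 ≤ A' u c * B' u c * -Real.log (A' u c) / η :=
        div_nonneg (mul_nonneg (hP0 u) (by
          have := Real.log_nonpos (hA'0 u c) (hA'1 u c); linarith)) hη.le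
      have n₂ : 0 ≤ A' u c * B' u c * -Real.log (B' u c) / η :=
        div_nonneg (mul_nonneg (hP0 u) (by
          have := Real.log_nonpos (hB'0 u c) (hB'1 u c); linarith)) hη.le
      rw [hl, add_div]
      have r₁ : B' u c * (Fintype.card ι * (η / 2) * A' u c + A' u c * -Real.log (A' u c) / η) =
        Fintype.card ι * (η / 2) * (A' u c * B' u c) +
          A' u c * B' u c * -Real.log (A' u c) / η := by ring
      have r₂ : A' u c * (Fintype.card ι * (η / 2) * B' u c + B' u c * -Real.log (B' u c) / η) =
        Fintype.card ι * (η / 2) * (A' u c * B' u c) +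
          A' u c * B' u c * -Real.log (B' u c) / η := by ring
      rw [r₁] at e₁
      rw [r₂] at e₂
      linarith
    have hent := sum_mul_neg_log_le hP0 hP1 hw
    calc _ = ∑ u, (24 * (B' u c * ∑ j, |𝔼 e, a u (onSet c e) * boolSign (e j)|) +
        12 * (A' u c * ∑ j, |𝔼 e, b u (offSet c e) * boolSign (e j)|)) := by
          simp only [Finset.sum_add_distrib, Finset.mul_sum]
          congr 1 <;> exact Finset.sum_comm
      _ ≤ ∑ u, 36 * (Fintype.card ι * (η / 2) * (A' u c * B' u c) +
          (A' u c * B' u c * -Real.log (A' u c * B' u c)) / η) := Finset.sum_le_sum fun u _ => hu u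
      _ = 36 * (Fintype.card ι * (η / 2) +
          (∑ u, A' u c * B' u c * -Real.log (A' u c * B' u c)) / η) := by
          rw [← Finset.mul_sum, Finset.sum_add_distrib, ← Finset.mul_sum, hP1, Finset.sum_div,
            mul_one]
      _ ≤ _ := by gcongr
  calc 𝔼 c, ∑ j, advantage a b c j ≤ 𝔼 c, ∑ j, (6 * t₁ c j + 3 * t₂ c j) :=
        Finset.expect_le_expect fun c _ => Finset.sum_le_sum fun j _ => hadv c j
    _ = 𝔼 c, ∑ j, (6 * (if c j = true then 2 * t₁ c j else 0) +
          3 * (if c j = false then 2 * t₂ c j else 0)) := by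
        rw [Finset.expect_sum_comm, Finset.expect_sum_comm]
        refine Finset.sum_congr rfl fun j _ => ?_
        rw [Finset.expect_add_distrib, Finset.expect_add_distrib, ← Finset.mul_expect,
          ← Finset.mul_expect, ht₁e, ht₂e, ← Finset.mul_expect, ← Finset.mul_expect]
    _ ≤ 𝔼 c, 36 * (Fintype.card ι * (η / 2) + (∑ u, A' u c * B' u c * w u) / η) := by
        refine Finset.expect_le_expect fun c _ => le_trans (Finset.sum_le_sum fun j _ => ?_) (hc c)
        have := hd₁ c j
        have := hd₂ c j
        linarith
    _ = _ := by
        rw [← Finset.mul_expect, Finset.expect_add_distrib, Fintype.expect_const,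
          ← Finset.expect_div]

end Cube

/-! ### The hard distribution of inputs -/

section Law

open scoped BigOperators

theorem expect_expect_arrow {ι A B : Type*} [Fintype ι] [DecidableEq ι] [Fintype A] [Fintype B]
    (Φ : (ι → A) → (ι → B) → ℝ) :
    𝔼 f, 𝔼 g, Φ f g = 𝔼 h : ι → A × B, Φ (fun l => (h l).1) (fun l => (h l).2) := by
  rw [← Finset.expect_product' Finset.univ Finset.univ Φ, Finset.univ_product_univ]
  exact (Fintype.expect_equiv (Equiv.arrowProdEquivProdArrow ι (fun _ => A) (fun _ => B)) _ _
    (fun h => rfl)).symm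

theorem expect_prod_arrow {ι A : Type*} [Fintype ι] [DecidableEq ι] [Fintype A]
    (h : ι → A → ℝ) : 𝔼 g : ι → A, ∏ l, h l (g l) = ∏ l, 𝔼 a, h l a := by
  have : ∏ l, ∑ a, h l a = ∑ g : ι → A, ∏ l, h l (g l) := by
    rw [Finset.prod_univ_sum, Fintype.piFinset_univ]
  simp only [Fintype.expect_eq_sum_div_card]
  rw [← this, Finset.prod_div_distrib]
  simp

/-- A function of independent, identically distributed columns, in terms of the law of a column. -/
theorem expect_comp_arrow {ι A B : Type*} [Fintype ι] [DecidableEq ι] [Fintype A] [Fintype B]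
    [DecidableEq B] (F : A → B) (φ : (ι → B) → ℝ) :
    𝔼 g : ι → A, φ (fun l => F (g l)) =
      ∑ W : ι → B, (∏ l, 𝔼 a, if F a = W l then (1 : ℝ) else 0) * φ W := by
  have h : ∀ g : ι → A, φ (fun l => F (g l)) =
      ∑ W : ι → B, (∏ l, if F (g l) = W l then (1 : ℝ) else 0) * φ W := by
    intro g
    rw [Finset.sum_eq_single (fun l => F (g l))]
    · simp
    · intro W _ hW
      obtain ⟨l, hl⟩ := Function.ne_iff.1 hW
      rw [Finset.prod_eq_zero (Finset.mem_univ l), zero_mul]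
      rw [if_neg (Ne.symm hl)]
    · simp
  simp only [h]
  rw [Finset.expect_sum_comm]
  refine Finset.sum_congr rfl fun W _ => ?_
  rw [← Finset.expect_mul, expect_prod_arrow (fun l a => if F a = W l then (1 : ℝ) else 0)]

/-- Independent, identically distributed columns are determined by the law of one column, so two
models need only be compared on a single column. -/
theorem expect_arrow_congr {ι A A' B : Type*} [Fintype ι] [DecidableEq ι] [Fintype A]
    [Fintype A'] [Fintype B] [DecidableEq B] (F : A → B) (F' : A' → B)
    (h : ∀ ψ : B → ℝ, 𝔼 a, ψ (F a) = 𝔼 a, ψ (F' a)) (φ : (ι → B) → ℝ) :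
    𝔼 g : ι → A, φ (fun l => F (g l)) = 𝔼 g : ι → A', φ (fun l => F' (g l)) := by
  rw [expect_comp_arrow, expect_comp_arrow]
  refine Finset.sum_congr rfl fun W _ => ?_
  congr 1
  exact Finset.prod_congr rfl fun l _ => h (fun b => if b = W l then 1 else 0)

/-- Exchanging `s` with `ρ i` is an involution of the pairs `(ρ, s)`. -/
theorem expect_resample {κ S : Type*} [Fintype κ] [DecidableEq κ] [Fintype S]
    (i : κ) (h : (κ → S) → ℝ) :
    𝔼 ρ : κ → S, 𝔼 s, h (Function.update ρ i s) = 𝔼 ρ, h ρ := by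
  rcases isEmpty_or_nonempty S with hS | hS
  · have : IsEmpty (κ → S) := ⟨fun f => hS.false (f i)⟩
    simp [Finset.expect]
  have hinv : Function.Involutive (fun p : (κ → S) × S => (Function.update p.1 i p.2, p.1 i)) := by
    intro p; simp
  rw [← Finset.expect_product' Finset.univ Finset.univ fun ρ s => h (Function.update ρ i s),
    Finset.univ_product_univ]
  have : 𝔼 ρ : κ → S, h ρ = 𝔼 p : (κ → S) × S, h p.1 := by
    rw [← Finset.univ_product_univ, Finset.expect_product' Finset.univ Finset.univ fun ρ _ => h ρ]
    simp
  rw [this]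
  exact Fintype.expect_equiv hinv.toPerm _ _ fun p => rfl

theorem expect_bool (f : Bool → ℝ) : 𝔼 b, f b = (f true + f false) / 2 := by
  rw [Fintype.expect_eq_sum_div_card, Fintype.sum_bool]; simp

variable {k n : ℕ}

/-- Inputs of `k` players, as matrices of bits; a column of `m` is zero, and the bits of the other
columns are set where `r` vanishes. -/
def bulk (m : Fin n → Bool) (r : Fin n → Fin k → Fin 3) : Fin k → Fin n → Bool :=
  fun i l => !m l && decide (r l i = 0)

/-- The average over the hard distribution of inputs: the columns are independent; a column is zero
with probability `1 / 4`, and otherwise its bits are independent and are set with probability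
`1 / 3`. -/
noncomputable def hardMean (φ : (Fin k → Fin n → Bool) → ℝ) : ℝ :=
  𝔼 q : Fin n → Fin 4, 𝔼 r : Fin n → Fin k → Fin 3, φ (bulk (fun l => decide (q l = 0)) r)

/-- The hard distribution from the point of view of player `i`. -/
theorem expect_update_bulk (i : Fin k) (φ : (Fin k → Fin n → Bool) → ℝ) :
    𝔼 c : Fin n → Bool, 𝔼 e : Fin n → Bool, 𝔼 e' : Fin n → Bool, 𝔼 r : Fin n → Fin k → Fin 3,
      φ (Function.update (bulk (offSet c e') r) i (onSet c e)) = hardMean φ := by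
  set F : (Bool × Bool × Bool × (Fin k → Fin 3)) → Fin k → Bool := fun a =>
    Function.update (fun i' => !(!a.1 && a.2.2.1) && decide (a.2.2.2 i' = 0)) i (a.1 && a.2.1)
    with hF
  set F' : (Fin 4 × (Fin k → Fin 3)) → Fin k → Bool := fun a i' =>
    !(decide (a.1 = 0)) && decide (a.2 i' = 0) with hF'
  have h₁ : hardMean φ = 𝔼 g : Fin n → Fin 4 × (Fin k → Fin 3),
      (fun W : Fin n → Fin k → Bool => φ (fun i l => W l i)) (fun l => F' (g l)) := by
    rw [hardMean, expect_expect_arrow]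
    rfl
  have h₂ : 𝔼 c : Fin n → Bool, 𝔼 e : Fin n → Bool, 𝔼 e' : Fin n → Bool,
      𝔼 r : Fin n → Fin k → Fin 3,
      φ (Function.update (bulk (offSet c e') r) i (onSet c e)) =
      𝔼 g : Fin n → Bool × Bool × Bool × (Fin k → Fin 3),
      (fun W : Fin n → Fin k → Bool => φ (fun i l => W l i)) (fun l => F (g l)) := by
    have e₁ : ∀ c e : Fin n → Bool, 𝔼 e' : Fin n → Bool, 𝔼 r : Fin n → Fin k → Fin 3,
        φ (Function.update (bulk (offSet c e') r) i (onSet c e)) =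
        𝔼 g : Fin n → Bool × (Fin k → Fin 3),
        φ (Function.update (bulk (offSet c fun l => (g l).1) fun l => (g l).2) i (onSet c e)) :=
      fun c e => expect_expect_arrow _
    simp only [e₁]
    have e₂ : ∀ c : Fin n → Bool, 𝔼 e : Fin n → Bool, 𝔼 g : Fin n → Bool × (Fin k → Fin 3),
        φ (Function.update (bulk (offSet c fun l => (g l).1) fun l => (g l).2) i (onSet c e)) =
        𝔼 g : Fin n → Bool × Bool × (Fin k → Fin 3),
        φ (Function.update (bulk (offSet c fun l => (g l).2.1) fun l => (g l).2.2) i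
          (onSet c fun l => (g l).1)) :=
      fun c => expect_expect_arrow (fun e (g : Fin n → Bool × (Fin k → Fin 3)) =>
        φ (Function.update (bulk (offSet c fun l => (g l).1) fun l => (g l).2) i (onSet c e)))
    simp only [e₂]
    rw [expect_expect_arrow (fun c (g : Fin n → Bool × Bool × (Fin k → Fin 3)) =>
        φ (Function.update (bulk (offSet c fun l => (g l).2.1) fun l => (g l).2.2) i
          (onSet c fun l => (g l).1)))]
    refine Finset.expect_congr rfl fun g _ => ?_
    congr 1
    funext i' l
    by_cases h : i' = i
    · subst h; simp [hF, onSet]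
    · simp [hF, h, bulk, offSet]
  rw [h₁, h₂]
  -- Four cases of a column are equally likely. If `c` is false and `e'` is true the column is zero.
  -- In the other three the remaining players have free bits, and player `i` has its bit set in
  -- exactly one of them, when `c` and `e` are true. This is the origin of `1 / 4` and `1 / 3`, and
  -- it gives the same law for every `i`.
  refine expect_arrow_congr (ι := Fin n) F F' (fun ψ => ?_) (fun W => φ (fun i l => W l i))
  set R : (Fin k → Fin 3) → Fin k → Bool := fun ρ i' => decide (ρ i' = 0) with hR
  have hres : 𝔼 ρ, ψ (R ρ) = 𝔼 ρ, ((1 / 3) * ψ (Function.update (R ρ) i true) +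
      (2 / 3) * ψ (Function.update (R ρ) i false)) := by
    rw [← expect_resample i (fun ρ => ψ (R ρ))]
    refine Finset.expect_congr rfl fun ρ _ => ?_
    have : ∀ s, R (Function.update ρ i s) = Function.update (R ρ) i (decide (s = 0)) := by
      intro s; funext i'
      by_cases h : i' = i
      · subst h; simp [hR]
      · simp [hR, h]
    simp only [this, Fintype.expect_eq_sum_div_card, Fin.sum_univ_three, Fintype.card_fin]
    simp
    ring
  have hz : Function.update (fun _ : Fin k => false) i false = (fun _ : Fin k => false) := by
    simp
  have hl : 𝔼 a, ψ (F a) = 𝔼 ρ, ((1 / 4) * ψ (Function.update (R ρ) i true) +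
      (1 / 2) * ψ (Function.update (R ρ) i false) + (1 / 4) * ψ (fun _ => false)) := by
    rw [← Finset.univ_product_univ, Finset.expect_product, ← Finset.univ_product_univ]
    simp only [Finset.expect_product]
    rw [← Finset.univ_product_univ]
    simp only [Finset.expect_product, hF, expect_bool, Bool.not_true, Bool.not_false,
      Bool.true_and, Bool.false_and, Bool.and_true, Bool.and_false, hz]
    simp only [Finset.expect_add_distrib, ← Finset.mul_expect, Fintype.expect_const, hR]
    ring
  have hr : 𝔼 a, ψ (F' a) = 𝔼 ρ, ((3 / 4) * ψ (R ρ) + (1 / 4) * ψ (fun _ => false)) := by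
    rw [← Finset.univ_product_univ, Finset.expect_product]
    simp only [Fintype.expect_eq_sum_div_card, Fin.sum_univ_four, Fintype.card_fin, hF',
      ← Finset.sum_div]
    simp only [Finset.sum_add_distrib, ← Finset.mul_sum, hR]
    simp
    ring
  rw [hl, hr, Finset.expect_add_distrib _ (fun ρ => 3 / 4 * ψ (R ρ)), ← Finset.mul_expect, hres]
  simp only [Finset.expect_add_distrib, ← Finset.mul_expect, Fintype.expect_const]
  ring

end Law

/-! ### The influence of one player's conversation -/

section Player

open scoped BigOperators

/-- The negative logarithm of a subprobability on the lists of bits. -/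
noncomputable def listWeight (u : List Bool) : ℝ := (2 * u.length + 1) * Real.log 2

theorem exp_neg_listWeight (u : List Bool) :
    Real.exp (-listWeight u) = (1 / 2) ^ (2 * u.length + 1) := by
  have h : Real.exp (listWeight u) = 2 ^ (2 * u.length + 1) := by
    rw [listWeight, mul_comm, Real.exp_mul, Real.exp_log (by norm_num)]
    exact_mod_cast Real.rpow_natCast (2 : ℝ) (2 * u.length + 1)
  rw [Real.exp_neg, h, one_div, inv_pow]

/-- The at most `2 ^ L` words of length `L` contribute at most `2 ^ (-L - 1)` together. The weight
uses twice the length because conversations need not form a prefix code here. -/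
theorem sum_exp_neg_listWeight_le (F : Finset (List Bool)) :
    ∑ u ∈ F, Real.exp (-listWeight u) ≤ 1 := by
  set N := F.sup List.length with hN
  have hmaps : ∀ u ∈ F, u.length ∈ Finset.range (N + 1) := fun u hu =>
    Finset.mem_range.2 (Nat.lt_succ_of_le (Finset.le_sup (f := List.length) hu))
  rw [← Finset.sum_fiberwise_of_maps_to hmaps]
  have hcard : ∀ L : ℕ, ((F.filter fun u => u.length = L).card : ℝ) ≤ 2 ^ L := by
    intro L
    have : (F.filter fun u => u.length = L).card ≤ Fintype.card (List.Vector Bool L) := by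
      rw [← Fintype.card_coe]
      refine Fintype.card_le_of_injective
        (fun u => (⟨u.1, (Finset.mem_filter.1 u.2).2⟩ : List.Vector Bool L)) fun u v h => ?_
      exact Subtype.ext (congrArg (fun w : List.Vector Bool L => w.1) h)
    rw [card_vector, Fintype.card_bool] at this
    exact_mod_cast this
  have hL : ∀ L : ℕ, ∑ u ∈ F.filter (fun u => u.length = L), Real.exp (-listWeight u) ≤
      (1 / 2) ^ L * (1 / 2) := by
    intro L
    calc _ = ∑ u ∈ F.filter (fun u => u.length = L), ((1 : ℝ) / 2) ^ (2 * L + 1) := by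
          refine Finset.sum_congr rfl fun u hu => ?_
          rw [exp_neg_listWeight, (Finset.mem_filter.1 hu).2]
      _ = (F.filter fun u => u.length = L).card * ((1 : ℝ) / 2) ^ (2 * L + 1) := by
          rw [Finset.sum_const, nsmul_eq_mul]
      _ ≤ 2 ^ L * ((1 : ℝ) / 2) ^ (2 * L + 1) := by gcongr; exact hcard L
      _ = _ := by
          rw [pow_succ, pow_mul, ← mul_assoc, ← mul_pow]
          norm_num
  calc _ ≤ ∑ L ∈ Finset.range (N + 1), ((1 : ℝ) / 2) ^ L * (1 / 2) :=
        Finset.sum_le_sum fun L _ => hL L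
    _ ≤ 1 := by
        rw [← Finset.sum_mul, geom_sum_eq (by norm_num)]
        have : (0 : ℝ) < (1 / 2) ^ (N + 1) := by positivity
        have h2 : (((1 : ℝ) / 2) ^ (N + 1) - 1) / (1 / 2 - 1) * (1 / 2) = 1 - (1 / 2) ^ (N + 1) := by
          ring
        linarith

variable {k n : ℕ} {𝒯 : Type*}

/-- Replace the column `j` of a matrix of bits. -/
def setCol (j : Fin n) (s : Fin k → Bool) (V : Fin k → Fin n → Bool) : Fin k → Fin n → Bool :=
  fun i => Function.update (V i) j (s i)

/-- Erasing column `j` for the others amounts to setting Bob's bit `j`, and the entry of player `i`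
is Alice's bit `j`. This is the situation measured by `advantage`. -/
theorem setCol_update_bulk (j : Fin n) (i : Fin k) (v : Bool) (m : Fin n → Bool)
    (r : Fin n → Fin k → Fin 3) (x : Fin n → Bool) :
    setCol j (fun i' => decide (i' = i) && v) (Function.update (bulk m r) i x) =
      Function.update (bulk (Function.update m j true) r) i (Function.update x j v) := by
  funext i' l
  by_cases hi : i' = i
  · subst hi; simp [setCol]
  · by_cases hl : l = j
    · subst hl; simp [setCol, hi, bulk]
    · simp [setCol, hi, bulk, hl]

open Classical in
/-- Each player's conversation has little influence on the rest of the execution. -/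
theorem sum_abs_hardMean_setCol_le (T : (Fin k → Fin n → Bool) → 𝒯) (u : 𝒯 → List Bool)
    (i : Fin k)
    (hcp : ∀ X X', u (T X) = u (T X') → T (Function.update X' i (X i)) = T X')
    (G : Fin n → 𝒯 → ℝ) (hG0 : ∀ j t, 0 ≤ G j t) (hG1 : ∀ j t, G j t ≤ 1)
    {η : ℝ} (hη : 0 < η) :
    ∑ j, |hardMean (fun V => G j (T (setCol j (fun i' => decide (i' = i) && true) V))) -
        hardMean (fun V => G j (T (setCol j (fun i' => decide (i' = i) && false) V)))| ≤
      36 * (n * (η / 2) + hardMean (fun V => listWeight (u (T V))) / η) := by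
  set F : Finset (List Bool) := Finset.univ.image fun V => u (T V) with hF
  have hmem : ∀ V, u (T V) ∈ F := fun V => Finset.mem_image_of_mem _ (Finset.mem_univ V)
  -- `a` and `β` are the two sides of the combinatorial rectangle of inputs with a given
  -- conversation: compatibility with the row of player `i`, and with all other rows.
  set a : F → (Fin n → Bool) → ℝ := fun s x => if ∃ V, V i = x ∧ u (T V) = s then 1 else 0 with ha
  set β : F → (Fin k → Fin n → Bool) → ℝ := fun s W =>
    if ∃ x, u (T (Function.update W i x)) = s then 1 else 0 with hβ
  set b : F → (Fin n → Bool) → ℝ := fun s m => 𝔼 r : Fin n → Fin k → Fin 3, β s (bulk m r)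
    with hb
  have haβ : ∀ s x W, a s x * β s W = if u (T (Function.update W i x)) = s then 1 else 0 := by
    intro s x W
    by_cases h : u (T (Function.update W i x)) = s
    · have h₁ : ∃ V, V i = x ∧ u (T V) = s := ⟨Function.update W i x, by simp, h⟩
      have h₂ : ∃ x, u (T (Function.update W i x)) = s := ⟨x, h⟩
      simp only [ha, hβ, if_pos h₁, if_pos h₂, if_pos h, mul_one]
    · rw [if_neg h]
      by_cases h₁ : ∃ V, V i = x ∧ u (T V) = s
      · have h₂ : ¬ ∃ x, u (T (Function.update W i x)) = s := by
          rintro ⟨x', hx'⟩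
          obtain ⟨V, rfl, hV⟩ := h₁
          have := hcp V (Function.update W i x') (hV.trans hx'.symm)
          rw [Function.update_idem] at this
          exact h (by rw [this, hx'])
        simp only [hβ, if_neg h₂, mul_zero]
      · simp only [ha, if_neg h₁, zero_mul]
  have hsum : ∀ (φ : F → ℝ) x W, ∑ s, a s x * β s W * φ s =
      φ ⟨u (T (Function.update W i x)), hmem _⟩ := by
    intro φ x W
    simp only [haβ]
    rw [Finset.sum_eq_single ⟨u (T (Function.update W i x)), hmem _⟩]
    · simp
    · intro s _ hs
      rw [if_neg, zero_mul]
      intro h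
      exact hs (Subtype.ext h.symm)
    · simp
  have ha0 : ∀ s x, 0 ≤ a s x := fun s x => by simp only [ha]; split_ifs <;> norm_num
  have ha1 : ∀ s x, a s x ≤ 1 := fun s x => by simp only [ha]; split_ifs <;> norm_num
  have hβ0 : ∀ s W, 0 ≤ β s W := fun s x => by simp only [hβ]; split_ifs <;> norm_num
  have hβ1 : ∀ s W, β s W ≤ 1 := fun s x => by simp only [hβ]; split_ifs <;> norm_num
  have hb0 : ∀ s x, 0 ≤ b s x := fun s x => Finset.expect_nonneg fun r _ => hβ0 _ _
  have hb1 : ∀ s x, b s x ≤ 1 := fun s x =>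
    Finset.expect_le Finset.univ_nonempty fun r _ => hβ1 _ _
  have hφ : ∀ (φ : F → ℝ) x m, ∑ s, a s x * b s m * φ s =
      𝔼 r : Fin n → Fin k → Fin 3, φ ⟨u (T (Function.update (bulk m r) i x)), hmem _⟩ := by
    intro φ x m
    simp only [← hsum]
    rw [Finset.expect_sum_comm]
    refine Finset.sum_congr rfl fun s _ => ?_
    simp only [hb]
    rw [← Finset.expect_mul, ← Finset.mul_expect]
  have hab : ∀ x m, ∑ s, a s x * b s m = 1 := by
    intro x m
    have := hφ (fun _ => 1) x m
    simpa using this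
  have hw : ∑ s : F, Real.exp (-listWeight s) ≤ 1 := by
    rw [Finset.sum_coe_sort F fun s => Real.exp (-listWeight s)]
    exact sum_exp_neg_listWeight_le F
  have main := expect_sum_advantage_le a b (fun s => listWeight s) ha0 ha1 hb0 hb1 hab hw hη
  have hcost : 𝔼 c, ∑ s, (𝔼 e, a s (onSet c e)) * (𝔼 e, b s (offSet c e)) * listWeight s =
      hardMean (fun V => listWeight (u (T V))) := by
    rw [← expect_update_bulk i]
    refine Finset.expect_congr rfl fun c _ => ?_
    have h := fun e e' => hφ (fun s => listWeight s) (onSet c e) (offSet c e')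
    simp only at h
    simp only [← h]
    simp only [Finset.expect_sum_comm]
    refine Finset.sum_congr rfl fun s _ => ?_
    simp only [← Finset.expect_mul, ← Finset.mul_expect]
  rw [hcost, Fintype.card_fin] at main
  refine le_trans ?_ main
  rw [Finset.expect_sum_comm]
  refine Finset.sum_le_sum fun j _ => ?_
  rw [← expect_update_bulk i, ← expect_update_bulk i, ← Finset.expect_sub_distrib]
  refine (Finset.abs_expect_le _ _).trans (Finset.expect_le_expect fun c _ => ?_)
  simp only [setCol_update_bulk]
  -- By cut and paste, the conversation and the other rows determine the whole transcript, whichever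
  -- compatible row is chosen for player `i`. Hence `G` factors through `γ`, which is at most `β`.
  set γ : F → (Fin k → Fin n → Bool) → ℝ := fun s W =>
    if h : ∃ x, u (T (Function.update W i x)) = s then
      G j (T (Function.update W i h.choose)) else 0 with hγ
  have hγ0 : ∀ s W, 0 ≤ γ s W := by
    intro s W; simp only [hγ]; split_ifs
    · exact hG0 _ _
    · exact le_rfl
  have hγβ : ∀ s W, γ s W ≤ β s W := by
    intro s W; simp only [hγ, hβ]; split_ifs
    · exact hG1 _ _
    · exact le_rfl
  have hGs : ∀ W x, G j (T (Function.update W i x)) = ∑ s, a s x * γ s W := by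
    intro W x
    rw [Finset.sum_eq_single ⟨u (T (Function.update W i x)), hmem _⟩]
    · have h₁ : ∃ V, V i = x ∧ u (T V) = u (T (Function.update W i x)) :=
        ⟨Function.update W i x, by simp, rfl⟩
      have h₂ : ∃ x', u (T (Function.update W i x')) = u (T (Function.update W i x)) := ⟨x, rfl⟩
      simp only [ha, hγ, if_pos h₁, dif_pos h₂, one_mul]
      have := hcp (Function.update W i x) (Function.update W i h₂.choose) h₂.choose_spec.symm
      rw [Function.update_idem, Function.update_self] at this
      exact congrArg (G j) this
    · intro s _ hs
      by_cases h₂ : ∃ x', u (T (Function.update W i x')) = s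
      · have h₃ : a s x = 0 := by
          have := haβ s x W
          rw [if_neg (fun h => hs (Subtype.ext h.symm))] at this
          simpa only [hβ, if_pos h₂, mul_one] using this
        rw [h₃, zero_mul]
      · simp only [hγ, dif_neg h₂, mul_zero]
    · simp
  set B : F → ℝ := fun s => 𝔼 e', 𝔼 r : Fin n → Fin k → Fin 3,
    γ s (bulk (Function.update (offSet c e') j true) r) with hB
  have hB0 : ∀ s, 0 ≤ B s :=
    fun s => Finset.expect_nonneg fun e' _ => Finset.expect_nonneg fun r _ => hγ0 _ _
  have hBb : ∀ s, B s ≤ 𝔼 e', b s (Function.update (offSet c e') j true) :=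
    fun s => Finset.expect_le_expect fun e' _ => Finset.expect_le_expect fun r _ => hγβ _ _
  have hv : ∀ v, 𝔼 e, 𝔼 e', 𝔼 r : Fin n → Fin k → Fin 3,
      G j (T (Function.update (bulk (Function.update (offSet c e') j true) r) i
        (Function.update (onSet c e) j v))) =
      ∑ s, (𝔼 e, a s (Function.update (onSet c e) j v)) * B s := by
    intro v
    simp only [hGs, hB]
    simp only [Finset.expect_sum_comm]
    refine Finset.sum_congr rfl fun s _ => ?_
    simp only [← Finset.expect_mul, ← Finset.mul_expect]
  rw [hv, hv, ← Finset.sum_sub_distrib, advantage]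
  refine (Finset.abs_sum_le_sum_abs _ _).trans (Finset.sum_le_sum fun s _ => ?_)
  rw [← sub_mul, abs_mul, abs_of_nonneg (hB0 s)]
  exact mul_le_mul_of_nonneg_left (hBb s) (abs_nonneg _)

end Player

/-! ### Exchanging the owner of a task with a random player -/

section Averaging

open scoped BigOperators

variable {k n : ℕ} {𝒯 : Type*}

theorem hardMean_mono {φ ψ : (Fin k → Fin n → Bool) → ℝ} (h : ∀ V, φ V ≤ ψ V) :
    hardMean φ ≤ hardMean ψ :=
  Finset.expect_le_expect fun _ _ => Finset.expect_le_expect fun _ _ => h _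

theorem hardMean_sum {α : Type*} (s : Finset α) (φ : α → (Fin k → Fin n → Bool) → ℝ) :
    hardMean (fun V => ∑ x ∈ s, φ x V) = ∑ x ∈ s, hardMean (φ x) := by
  simp only [hardMean, Finset.expect_sum_comm]

theorem hardMean_const (a : ℝ) : hardMean (fun _ : Fin k → Fin n → Bool => a) = a := by
  simp [hardMean]

/-- Give the task `l` to the player `Z l`, in addition to the tasks in `V`. -/
def orOwner (Z : Fin n → Fin k) (V : Fin k → Fin n → Bool) : Fin k → Fin n → Bool :=
  fun i l => V i l || decide (Z l = i)

/-- For fixed owners, `orOwner` modifies each row separately, so the cut-and-paste property survives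
composition with it. -/
theorem orOwner_update (Z : Fin n → Fin k) (V V' : Fin k → Fin n → Bool) (i : Fin k) :
    orOwner Z (Function.update V' i (V i)) =
      Function.update (orOwner Z V') i (orOwner Z V i) := by
  funext i' l
  by_cases h : i' = i
  · subst h; simp [orOwner]
  · simp [orOwner, h]

/-- Column `j` consists of `i` and `Z j` on both sides; it does not reveal which of the two is the
owner. -/
theorem orOwner_setCol (Z : Fin n → Fin k) (V : Fin k → Fin n → Bool) (i : Fin k) (j : Fin n) :
    orOwner Z (setCol j (fun i' => decide (i' = i) && true) V) =
      orOwner (Function.update Z j i)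
        (setCol j (fun i' => decide (i' = Z j) && true) V) := by
  funext i' l
  by_cases h : l = j
  · subst h
    simp [orOwner, setCol, Bool.or_comm, eq_comm]
  · simp [orOwner, setCol, h]

/-- The exchange of `i` with `Z j` is an involution of the uniformly distributed pairs `(i, Z)`. -/
theorem expect_swap (j : Fin n) (Φ : (Fin n → Fin k) → Fin k → ℝ) :
    𝔼 i, 𝔼 Z, Φ (Function.update Z j i) (Z j) = 𝔼 i, 𝔼 Z, Φ Z i := by
  have hinv : Function.Involutive
      (fun p : Fin k × (Fin n → Fin k) => (p.2 j, Function.update p.2 j p.1)) := by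
    intro p; simp
  rw [← Finset.expect_product' Finset.univ Finset.univ
      fun i Z => Φ (Function.update Z j i) (Z j),
    ← Finset.expect_product' Finset.univ Finset.univ fun i Z => Φ Z i, Finset.univ_product_univ]
  exact Fintype.expect_equiv hinv.toPerm _ _ fun p => rfl

open Classical in
/-- If every task of a random input in the hard distribution has an owner, and one task has no
other owner than that, then this unique owner is rarely found. -/
theorem sum_expect_hardMean_le [NeZero k] (T : (Fin k → Fin n → Bool) → 𝒯)
    (ch : Fin k → 𝒯 → List Bool) (Y : 𝒯 → Fin n → Option (Fin k)) (C : ℕ)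
    (hcp : ∀ i X X', ch i (T X) = ch i (T X') → T (Function.update X' i (X i)) = T X')
    (hC : ∀ X, ∑ i, (ch i (T X)).length ≤ C) {η : ℝ} (hη : 0 < η) :
    ∑ j, 𝔼 Z : Fin n → Fin k, hardMean (fun V =>
        if Y (T (orOwner Z (setCol j (fun _ => false) V))) j = some (Z j) then (1 : ℝ) else 0) ≤
      n / k + 72 * (n * (η / 2) + (2 * C + k) / (k * η)) := by
  set p : (Fin n → Fin k) → Fin n → (Fin k → Bool) → Fin k → ℝ := fun Z j s y =>
    hardMean (fun V => if Y (T (orOwner Z (setCol j s V))) j = some y then (1 : ℝ) else 0) with hp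
  set e : Fin k → Fin k → Bool := fun i i' => decide (i' = i) && true with he
  have hH : ∀ Z : Fin n → Fin k,
      ∑ i, hardMean (fun V => listWeight (ch i (T (orOwner Z V)))) ≤ 2 * C + k := by
    intro Z
    rw [← hardMean_sum]
    refine (hardMean_mono (ψ := fun _ => 2 * C + k) fun V => ?_).trans_eq (hardMean_const _)
    simp only [listWeight, ← Finset.sum_mul, Finset.sum_add_distrib, ← Finset.mul_sum]
    have h1 : (∑ i, ((ch i (T (orOwner Z V))).length : ℝ)) ≤ C := by
      exact_mod_cast hC (orOwner Z V)
    have h2 : Real.log 2 ≤ 1 := by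
      have := Real.log_two_lt_d9; linarith
    have h3 : 0 ≤ ∑ i, ((ch i (T (orOwner Z V))).length : ℝ) :=
      Finset.sum_nonneg fun i _ => Nat.cast_nonneg _
    simp only [Finset.sum_const, Finset.card_univ, Fintype.card_fin, nsmul_eq_mul, mul_one]
    have h4 : (0 : ℝ) ≤ k := Nat.cast_nonneg _
    nlinarith [mul_nonneg h3 (sub_nonneg.2 h2), mul_nonneg h4 (sub_nonneg.2 h2)]
  -- The named player `y j` may vary with `j`; both the owner and the added player will be
  -- substituted for it.
  have hΔ : ∀ (Z : Fin n → Fin k) (i : Fin k) (y : Fin n → Fin k),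
      ∑ j, |p Z j (e i) (y j) - p Z j (fun _ => false) (y j)| ≤
        36 * (n * (η / 2) + hardMean (fun V => listWeight (ch i (T (orOwner Z V)))) / η) := by
    intro Z i y
    have := sum_abs_hardMean_setCol_le (fun V => T (orOwner Z V)) (ch i) i
      (fun V V' h => by
        show T (orOwner Z (Function.update V' i (V i))) = T (orOwner Z V')
        rw [orOwner_update]
        exact hcp i _ _ h)
      (fun j t => if Y t j = some (y j) then 1 else 0)
      (fun j t => by split_ifs <;> norm_num) (fun j t => by split_ifs <;> norm_num) hη
    simpa [hp, he] using this
  set D : ℝ := 36 * (n * (η / 2) + (2 * C + k) / (k * η)) with hD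
  have hΔavg : ∀ y : Fin k → (Fin n → Fin k) → Fin n → Fin k,
      𝔼 i, 𝔼 Z, ∑ j, |p Z j (e i) (y i Z j) - p Z j (fun _ => false) (y i Z j)| ≤ D := by
    intro y
    rw [Finset.expect_comm]
    refine Finset.expect_le Finset.univ_nonempty fun Z _ => ?_
    refine (Finset.expect_le_expect fun i _ => hΔ Z i (y i Z)).trans ?_
    rw [← Finset.mul_expect, Finset.expect_add_distrib, Fintype.expect_const,
      Fintype.expect_eq_sum_div_card, Fintype.card_fin, ← Finset.sum_div, hD, div_div, mul_comm η]
    have hk : (0 : ℝ) < k := Nat.cast_pos.2 (NeZero.pos k)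
    have := hH Z
    gcongr
  have hswap : ∀ j, 𝔼 i, 𝔼 Z, p Z j (e i) (Z j) = 𝔼 i, 𝔼 Z, p Z j (e i) i := by
    intro j
    rw [← expect_swap j fun Z i => p Z j (e i) i]
    refine Finset.expect_congr rfl fun i _ => Finset.expect_congr rfl fun Z _ => ?_
    simp only [hp, he, orOwner_setCol Z]
  -- At most one player is named for task `j`, so the events for different `i` are disjoint, and
  -- here neither the input nor its law depends on `i`.
  have hone : ∀ j, 𝔼 i, 𝔼 Z, p Z j (fun _ => false) i ≤ 1 / k := by
    intro j
    rw [Finset.expect_comm]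
    refine Finset.expect_le Finset.univ_nonempty fun Z _ => ?_
    rw [Fintype.expect_eq_sum_div_card, Fintype.card_fin]
    gcongr
    simp only [hp]
    rw [← hardMean_sum]
    refine (hardMean_mono (ψ := fun _ => 1) fun V => ?_).trans_eq (hardMean_const _)
    rcases h : Y (T (orOwner Z (setCol j (fun _ => false) V))) j with _ | y
    · simp
    · simp
  -- Add `i` to the column, exchange it with the owner, and remove it again; each change of the
  -- column costs one influence term.
  have hstep : ∀ j, 𝔼 Z : Fin n → Fin k, p Z j (fun _ => false) (Z j) ≤
      1 / k + 𝔼 i, 𝔼 Z : Fin n → Fin k, |p Z j (e i) (Z j) - p Z j (fun _ => false) (Z j)| +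
        𝔼 i, 𝔼 Z : Fin n → Fin k, |p Z j (e i) i - p Z j (fun _ => false) i| := by
    intro j
    have h1 : 𝔼 Z : Fin n → Fin k, p Z j (fun _ => false) (Z j) ≤
        𝔼 i, 𝔼 Z, p Z j (e i) (Z j) +
        𝔼 i, 𝔼 Z : Fin n → Fin k, |p Z j (e i) (Z j) - p Z j (fun _ => false) (Z j)| := by
      rw [← Finset.expect_add_distrib]
      refine Finset.le_expect Finset.univ_nonempty fun i _ => ?_
      rw [← Finset.expect_add_distrib]
      refine Finset.expect_le_expect fun Z _ => ?_
      have := neg_abs_le (p Z j (e i) (Z j) - p Z j (fun _ => false) (Z j))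
      linarith
    have h2 : 𝔼 i, 𝔼 Z, p Z j (e i) i ≤ 𝔼 i, 𝔼 Z, p Z j (fun _ => false) i +
        𝔼 i, 𝔼 Z : Fin n → Fin k, |p Z j (e i) i - p Z j (fun _ => false) i| := by
      rw [← Finset.expect_add_distrib]
      refine Finset.expect_le_expect fun i _ => ?_
      rw [← Finset.expect_add_distrib]
      refine Finset.expect_le_expect fun Z _ => ?_
      have := le_abs_self (p Z j (e i) i - p Z j (fun _ => false) i)
      linarith
    have h3 := hone j
    rw [hswap j] at h1
    linarith
  calc _ ≤ ∑ j : Fin n, ((1 : ℝ) / k +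
        𝔼 i, 𝔼 Z : Fin n → Fin k, |p Z j (e i) (Z j) - p Z j (fun _ => false) (Z j)| +
        𝔼 i, 𝔼 Z : Fin n → Fin k, |p Z j (e i) i - p Z j (fun _ => false) i|) :=
        Finset.sum_le_sum fun j _ => hstep j
    _ = n / k + 𝔼 i, 𝔼 Z : Fin n → Fin k,
          ∑ j, |p Z j (e i) (Z j) - p Z j (fun _ => false) (Z j)| +
        𝔼 i, 𝔼 Z : Fin n → Fin k, ∑ j, |p Z j (e i) i - p Z j (fun _ => false) i| := by
        simp only [Finset.sum_add_distrib, Finset.expect_sum_comm]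
        simp [div_eq_mul_inv]
    _ ≤ n / k + D + D := by
        gcongr
        · exact hΔavg fun i Z j => Z j
        · exact hΔavg fun i Z j => i
    _ = _ := by rw [hD]; ring

end Averaging

/-! ### Averaging over the coins and choice of the constants -/

section LowerBound

open scoped BigOperators

open Classical in
/-- If every event of a finite family is unlikely, then some outcome avoids most of them. -/
theorem card_mul_le_of_forall_sum_le {Ω α : Type*} [MeasurableSpace Ω] (μ : Measure Ω)
    [IsProbabilityMeasure μ] [Fintype α] (F : α → Set Ω) {δ s : ℝ} (hδ : 0 ≤ δ)
    (hF : ∀ a, μ (F a) ≤ ENNReal.ofReal δ)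
    (hs : ∀ ρ, ∑ a, (if ρ ∈ F a then (0 : ℝ) else 1) ≤ s) :
    Fintype.card α * (1 - δ) ≤ s := by
  -- The failure events are not known to be measurable; passing to measurable hulls preserves their
  -- measure and only shrinks the success events.
  set M : α → Set Ω := fun a => (toMeasurable μ (F a))ᶜ with hM
  have hMm : ∀ a, MeasurableSet (M a) := fun a => (measurableSet_toMeasurable _ _).compl
  have hμM : ∀ a, 1 - δ ≤ μ.real (M a) := by
    intro a
    rw [hM, probReal_compl_eq_one_sub (measurableSet_toMeasurable _ _), measureReal_def,
      measure_toMeasurable]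
    have := ENNReal.toReal_le_of_le_ofReal hδ (hF a)
    linarith
  have hint : ∀ a, Integrable ((M a).indicator (1 : Ω → ℝ)) μ :=
    fun a => (integrable_indicator_iff (hMm a)).2 integrableOn_const
  have h1 : ∫ ρ, ∑ a, (M a).indicator (1 : Ω → ℝ) ρ ∂μ ≤ ∫ _, s ∂μ := by
    refine integral_mono (integrable_finsetSum _ fun a _ => hint a) (integrable_const _)
      fun ρ => (Finset.sum_le_sum fun a _ => ?_).trans (hs ρ)
    by_cases h : ρ ∈ F a
    · rw [Set.indicator_of_notMem]
      · rw [if_pos h]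
      · exact fun h' => h' (subset_toMeasurable _ _ h)
    · rw [if_neg h]
      exact Set.indicator_le_self' (fun _ _ => zero_le_one) ρ
  rw [integral_finsetSum _ fun a _ => hint a] at h1
  simp only [integral_indicator_one (hMm _), integral_const, probReal_univ, one_smul] at h1
  calc (Fintype.card α : ℝ) * (1 - δ) = ∑ _a : α, (1 - δ) := by
        rw [Finset.sum_const, Finset.card_univ, nsmul_eq_mul]
    _ ≤ ∑ a, μ.real (M a) := Finset.sum_le_sum fun a _ => hμM a
    _ ≤ s := h1

instance {k : ℕ} {In Out : Type} (P : Protocol k In Out) : IsProbabilityMeasure P.law := by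
  unfold Protocol.law; infer_instance

variable {k n : ℕ}

/-- The set of the positions where a vector of bits is set. -/
def support (x : Fin n → Bool) : Finset (Fin n) := Finset.univ.filter fun l => x l = true

/-- The easy direction of Yao's principle. Each input succeeds with probability at least `1 - δ`, so
some outcome of the coins does at least as well on average over the hard inputs, and for fixed coins
`sum_expect_hardMean_le` applies. -/
theorem le_of_solves_taskAllocation [NeZero k] [NeZero n] {δ : ℝ} (hδ : 0 ≤ δ)
    (P : Protocol k (Finset (Fin n)) (Fin n → Fin k)) (hP : P.Solves (taskAllocation n k) δ)
    {C : ℕ} (hC : P.cost ≤ C) {η : ℝ} (hη : 0 < η) :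
    n * (1 - δ) ≤ n / k + 72 * (n * (η / 2) + (2 * C + k) / (k * η)) := by
  classical
  set X : Fin n × (Fin n → Fin k) × (Fin n → Fin 4) × (Fin n → Fin k → Fin 3) →
      Fin k → Fin n → Bool := fun a =>
    orOwner a.2.1 (setCol a.1 (fun _ => false) (bulk (fun l => decide (a.2.2.1 l = 0)) a.2.2.2))
    with hX
  set s : ℝ := n / k + 72 * (n * (η / 2) + (2 * C + k) / (k * η)) with hs
  set N : ℝ :=
    ((Fintype.card ((Fin n → Fin k) × (Fin n → Fin 4) × (Fin n → Fin k → Fin 3)) : ℕ) : ℝ) with hN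
  have hNpos : 0 < N := by rw [hN]; exact_mod_cast Fintype.card_pos
  have key := card_mul_le_of_forall_sum_le P.law
    (fun a => {ρ | ¬ ∃ τ y, P.Ends (fun i => support (X a i)) ρ τ y ∧
      (taskAllocation n k).correct (fun i => support (X a i)) y}) hδ (s := N * s)
    (fun a => hP _ fun l => ⟨a.2.1 l, by simp [support, hX, orOwner]⟩) ?_
  · rw [Fintype.card_prod, Fintype.card_fin] at key
    push_cast only [Nat.cast_mul] at key
    rw [← hN] at key
    have : N * (n * (1 - δ)) ≤ N * s := by linarith
    exact le_of_mul_le_mul_left this hNpos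
  intro ρ
  set T : (Fin k → Fin n → Bool) → Transcript k := fun V =>
    P.exec (fun i => support (V i)) ρ (C + 1) with hT
  -- The value `none` covers transcripts after which the coordinator would send a bit instead of
  -- answering.
  set Y : Transcript k → Fin n → Option (Fin k) := fun τ j =>
    (P.coord ρ.1 τ).elim (fun y => some (y j)) (fun _ => none) with hY
  have main := sum_expect_hardMean_le T channel Y C (fun i V V' h => by
      have := P.exec_update (fun i => support (V i)) (fun i => support (V' i)) ρ (C + 1) i h le_rfl
      simp only [hT]
      rw [← this]
      congr 1
      funext i'
      by_cases hi : i' = i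
      · subst hi; simp
      · simp [hi]) (fun V => by
      rw [sum_length_channel]
      exact_mod_cast (P.length_exec_le_cost _ _ _).trans hC) hη
  rw [← hs] at main
  refine le_trans (le_trans (Finset.sum_le_sum
    (g := fun a => if Y (T (X a)) a.1 = some (a.2.1 a.1) then (1 : ℝ) else 0) fun a _ => ?_)
    (le_of_eq ?_)) (mul_le_mul_of_nonneg_left main hNpos.le)
  · by_cases h : ∃ τ y, P.Ends (fun i => support (X a i)) ρ τ y ∧
      (taskAllocation n k).correct (fun i => support (X a i)) y
    · obtain ⟨τ, y, he, hy⟩ := id h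
      obtain ⟨y', he'⟩ := P.exists_ends hC (fun i => support (X a i)) ρ
      obtain ⟨rfl, rfl⟩ := he.unique he'
      have h1 := (P.next_eq_inl_iff.1 he.2).2
      have h2 := hy a.1
      -- Column `a.1` is empty apart from its owner, so only the owner is a correct answer.
      have h3 : a.2.1 a.1 = y a.1 := by
        simpa [support, hX, orOwner, setCol] using h2
      have h4 : Y (T (X a)) a.1 = some (a.2.1 a.1) := by
        simp only [hY, hT]
        rw [h1, h3]
        rfl
      rw [if_pos h4]
      split_ifs <;> norm_num
    · rw [if_pos (by exact h)]
      split_ifs <;> norm_num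
  · rw [Fintype.sum_prod_type, Finset.mul_sum]
    refine Finset.sum_congr rfl fun j _ => ?_
    simp only [hardMean]
    rw [hN, ← Fintype.card_mul_expect]
    congr 1
    rw [← Finset.univ_product_univ, Finset.expect_product]
    refine Finset.expect_congr rfl fun Z _ => ?_
    rw [← Finset.univ_product_univ, Finset.expect_product]

theorem taskAllocation_lower_bound (δ : ℝ) (hδ0 : 0 ≤ δ) (hδ1 : δ < 1) :
    ∃ c : ℝ, 0 < c ∧ ∃ a₀ : ℝ, 0 < a₀ ∧ ∃ n₀ : ℕ,
      ∀ a : ℝ, a₀ ≤ a → ∀ n : ℕ, n₀ ≤ n → ∀ k : ℕ, a * Real.log n ≤ (k : ℝ) →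
        ENNReal.ofReal (c * ((n : ℝ) * k)) ≤ ((taskAllocation n k).cc δ : ℝ≥0∞) := by
  set ε := 1 - δ with hε
  have hεpos : 0 < ε := by linarith
  -- With these constants each of the four error terms, from `n / k`, `η / 2`, `2 * C` and `1 / η`,
  -- is at most `n * ε / 5`, whereas success requires `n * ε`.
  set η := ε / 180 with hη
  have hηpos : 0 < η := by positivity
  set c := ε * η / 720 with hc
  have hcpos : 0 < c := by positivity
  obtain ⟨n₁, hn₁⟩ := exists_nat_ge (360 / (η * ε))
  obtain ⟨n₂, hn₂⟩ := exists_nat_ge (Real.exp (5 / ε))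
  refine ⟨c, hcpos, 1, one_pos, n₁ + n₂ + 1, fun a ha n hn k hk => ?_⟩
  have hnpos : 0 < n := by omega
  have hnr : (0 : ℝ) < n := by exact_mod_cast hnpos
  have hn1 : 360 / (η * ε) ≤ n := hn₁.trans (by exact_mod_cast (by omega : n₁ ≤ n))
  have hn2 : Real.exp (5 / ε) ≤ n := hn₂.trans (by exact_mod_cast (by omega : n₂ ≤ n))
  -- The growth of `k` with `log n` serves only to make `1 / k` small compared with `ε`.
  have hk5 : 5 / ε ≤ k := by
    have h1 := (Real.le_log_iff_exp_le hnr).2 hn2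
    have h2 : 0 ≤ Real.log n := le_trans (by positivity) h1
    nlinarith
  have hkr : (0 : ℝ) < k := lt_of_lt_of_le (by positivity) hk5
  have hkpos : 0 < k := by exact_mod_cast hkr
  have : NeZero k := ⟨hkpos.ne'⟩
  have : NeZero n := ⟨hnpos.ne'⟩
  have hgoal : ∀ P : Protocol k (Finset (Fin n)) (Fin n → Fin k),
      P.Solves (taskAllocation n k) δ → ((⌈c * (n * k)⌉₊ : ℕ) : ℕ∞) ≤ P.cost := by
    intro P hP
    by_contra hlt
    rw [not_le] at hlt
    obtain ⟨C, hC⟩ := ENat.ne_top_iff_exists.1 (ne_top_of_lt hlt)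
    rw [← hC] at hlt
    have hCc : (C : ℝ) < c * (n * k) := Nat.lt_ceil.1 (by exact_mod_cast hlt)
    have key := le_of_solves_taskAllocation hδ0 P hP hC.symm.le hηpos
    rw [← hε] at key
    have e1 : (n : ℝ) / k ≤ n * (ε / 5) := by
      rw [div_le_iff₀ hkr]
      rw [div_le_iff₀ hεpos] at hk5
      nlinarith
    have e2 : (2 * (C : ℝ) + k) / (k * η) ≤ n * (2 * c / η) + 1 / η := by
      rw [div_le_iff₀ (by positivity)]
      have : (n * (2 * c / η) + 1 / η) * (k * η) = 2 * (c * (n * k)) + k := by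
        field_simp
      rw [this]; linarith
    have e3 : 2 * c / η = ε / 360 := by rw [hc]; field_simp; norm_num
    have e4 : 1 / η ≤ n * (ε / 360) := by
      rw [div_le_iff₀ (by positivity)] at hn1 ⊢
      nlinarith
    rw [e3] at e2
    have e5 : 0 < n * ε := by positivity
    nlinarith
  have h1 : ((⌈c * (n * k)⌉₊ : ℕ) : ℕ∞) ≤ (taskAllocation n k).cc δ :=
    le_iInf fun P => le_iInf fun hP => hgoal P hP
  calc ENNReal.ofReal (c * ((n : ℝ) * k)) ≤ ENNReal.ofReal (⌈c * (n * k)⌉₊ : ℕ) :=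
        ENNReal.ofReal_le_ofReal (Nat.le_ceil _)
    _ = (((⌈c * (n * k)⌉₊ : ℕ) : ℕ∞) : ℝ≥0∞) := by simp
    _ ≤ _ := by exact_mod_cast h1

end LowerBound

/-! ### Marking the first use of each channel -/

section Flag

variable {k : ℕ} {In Out : Type}

/-- Delete the last bit on each channel. -/
def dropLastOnChannels : Transcript k → Transcript k
  | [] => []
  | e :: l => if channel e.1 l = [] then dropLastOnChannels l else e :: dropLastOnChannels l

/-- Delete the first bit on each channel. -/
def unflag (σ : Transcript k) : Transcript k := (dropLastOnChannels σ.reverse).reverse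

theorem channel_reverse (i : Fin k) (σ : Transcript k) :
    channel i σ.reverse = (channel i σ).reverse := by
  simp [channel]

theorem unflag_snoc (σ : Transcript k) (e : Fin k × Bool) :
    unflag (σ ++ [e]) = if channel e.1 σ = [] then unflag σ else unflag σ ++ [e] := by
  simp only [unflag, List.reverse_append, List.reverse_singleton, List.singleton_append,
    dropLastOnChannels, channel_reverse, List.reverse_eq_nil_iff]
  split_ifs <;> simp

theorem channel_unflag (i : Fin k) (σ : Transcript k) :
    channel i (unflag σ) = (channel i σ).tail := by
  induction σ using List.reverseRecOn with
  | nil => rfl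
  | append_singleton σ e ih =>
    rw [unflag_snoc, channel_snoc]
    by_cases hi : e.1 = i
    · subst hi
      by_cases h : channel e.1 σ = []
      · simp [h, ih]
      · simp [h, channel_snoc, ih, List.tail_append_of_ne_nil]
    · split_ifs <;> simp [channel_snoc, hi, ih]

theorem length_le_length_unflag (σ : Transcript k) : σ.length ≤ (unflag σ).length + k := by
  rw [← sum_length_channel, ← sum_length_channel]
  calc ∑ i, (channel i σ).length ≤ ∑ i, ((channel i (unflag σ)).length + 1) := by
        refine Finset.sum_le_sum fun i _ => ?_
        rw [channel_unflag, List.length_tail]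
        omega
    _ = _ := by rw [Finset.sum_add_distrib]; simp

theorem channel_ne_nil_of_getLast {τ : Transcript k} {i : Fin k} {b : Bool}
    (h : τ.getLast? = some (i, b)) : channel i τ ≠ [] := by
  obtain ⟨l, rfl⟩ := List.getLast?_eq_some_iff.1 h
  rw [channel_snoc]; simp

namespace Protocol

/-- The protocol in which the coordinator sends the extra bit `false` on each channel before it is
used for the first time. -/
@[reducible] def flag (P : Protocol k In Out) : Protocol k In Out where
  CoordCoins := P.CoordCoins
  PlayerCoins := P.PlayerCoins
  coordLaw := P.coordLaw
  playerLaw := P.playerLaw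
  -- After the flag alone the coordinator still has to send the first bit of `P`, whatever
  -- `P.playerTurn` says of the empty history.
  playerTurn i h := decide (2 ≤ h.length) && P.playerTurn i h.tail
  coord r σ := Sum.map id (fun e => if channel e.1 σ = [] then (e.1, false) else e)
    (P.coord r (unflag σ))
  player i r x h := P.player i r x h.tail
  measurableSet_coord σ a := by
    rcases a with y | e
    · convert P.measurableSet_coord (unflag σ) (Sum.inl y) using 3 with r
      rcases P.coord r (unflag σ) with y' | e' <;> simp
    · have : {r | Sum.map id (fun e => if channel e.1 σ = [] then (e.1, false) else e)
          (P.coord r (unflag σ)) = (Sum.inr e : Out ⊕ (Fin k × Bool))} =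
          ⋃ e' ∈ {e' : Fin k × Bool | (if channel e'.1 σ = [] then (e'.1, false) else e') = e},
            {r | P.coord r (unflag σ) = Sum.inr e'} := by
        ext r
        rcases h : P.coord r (unflag σ) with y' | e' <;> simp [h]
      rw [this]
      exact MeasurableSet.biUnion (Set.to_countable _) fun e' _ => P.measurableSet_coord _ _
  measurableSet_player i x h b := P.measurableSet_player i x h.tail b

variable (P : Protocol k In Out) {X : Fin k → In} {ρ : P.Coins} {τ σ : Transcript k} {y : Out}

/-- The transcript `σ` of `P.flag` corresponds to the transcript `τ` of `P`. -/
structure FlagRel (τ σ : Transcript k) : Prop where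
  unflag_eq : unflag σ = τ
  getLast_eq : σ.getLast? = τ.getLast?
  channel_eq : ∀ i, channel i σ = if channel i τ = [] then [] else false :: channel i τ

theorem FlagRel.snoc (h : FlagRel τ σ) {e : Fin k × Bool} (he : channel e.1 τ ≠ []) :
    FlagRel (τ ++ [e]) (σ ++ [e]) where
  unflag_eq := by
    have := h.channel_eq e.1
    rw [if_neg he] at this
    rw [unflag_snoc, this, if_neg (by simp), h.unflag_eq]
  getLast_eq := by simp
  channel_eq i := by
    rw [channel_snoc, channel_snoc, h.channel_eq i]
    by_cases hi : e.1 = i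
    · subst hi; simp [he]
    · simp [hi]

theorem FlagRel.snoc_snoc (h : FlagRel τ σ) {i : Fin k} {b : Bool} (he : channel i τ = []) :
    FlagRel (τ ++ [(i, b)]) (σ ++ [(i, false)] ++ [(i, b)]) where
  unflag_eq := by
    have := h.channel_eq i
    rw [if_pos he] at this
    rw [unflag_snoc, channel_snoc, if_neg (by simp), unflag_snoc, if_pos this, h.unflag_eq]
  getLast_eq := by simp
  channel_eq j := by
    rw [channel_snoc, channel_snoc, channel_snoc, h.channel_eq j]
    by_cases hi : i = j
    · subst hi; simp [he]
    · simp [hi]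

theorem flag_dueTurn_iff (h : FlagRel τ σ) : P.flag.dueTurn σ ↔ P.dueTurn τ := by
  unfold dueTurn
  rw [h.getLast_eq]
  refine exists_congr fun i => exists_congr fun b => and_congr_right fun hl => ?_
  have hne := channel_ne_nil_of_getLast hl
  rw [h.channel_eq i, if_neg hne]
  have : 1 ≤ (channel i τ).length := List.length_pos_iff.2 hne
  simp [this]

/-- The transcript `σ` of `P.flag` ends with a flag, sent before the next bit of `P` after `τ`. -/
def FlagPending (ρ : P.Coins) (τ σ : Transcript k) : Prop :=
  ∃ σ₀ i b, σ = σ₀ ++ [(i, false)] ∧ FlagRel τ σ₀ ∧ channel i τ = [] ∧ ¬ P.dueTurn τ ∧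
    P.coord ρ.1 τ = Sum.inr (i, b)

theorem flag_next_of_pending (h : P.FlagPending ρ τ σ) :
    ∃ σ₀ i b, σ = σ₀ ++ [(i, false)] ∧ FlagRel τ σ₀ ∧ channel i τ = [] ∧
      P.next X ρ τ = Sum.inr (i, b) ∧ P.flag.next X ρ σ = Sum.inr (i, b) := by
  obtain ⟨σ₀, i, b, rfl, hrel, hi, hd, hc⟩ := h
  have hi' : channel i σ₀ = [] := by rw [hrel.channel_eq, if_pos hi]
  refine ⟨σ₀, i, b, rfl, hrel, hi, by rw [P.next_of_not_dueTurn hd, hc], ?_⟩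
  rw [P.flag.next_of_not_dueTurn]
  · show Sum.map id _ (P.coord ρ.1 (unflag (σ₀ ++ [(i, false)]))) = _
    rw [unflag_snoc, if_pos hi', hrel.unflag_eq, hc]
    simp [channel_snoc]
  · rintro ⟨i', b', hl, ht⟩
    simp only [List.getLast?_append, List.getLast?_singleton, Option.some_or, Option.some.injEq,
      Prod.mk.injEq] at hl
    obtain ⟨rfl, rfl⟩ := hl
    simp [channel_snoc, hi'] at ht

/-- A step of `P` corresponds to one step of `P.flag`, or to two if it opens a channel;
`FlagPending` is the state between these two. -/
theorem exists_flagRel (X : Fin k → In) (ρ : P.Coins) (m : ℕ) :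
    ∃ m', FlagRel (P.exec X ρ m') (P.flag.exec X ρ m) ∨
      P.FlagPending ρ (P.exec X ρ m') (P.flag.exec X ρ m) := by
  induction m with
  | zero => exact ⟨0, Or.inl ⟨rfl, rfl, fun i => by simp [exec]⟩⟩
  | succ m ih =>
    obtain ⟨m', h | h⟩ := ih
    · by_cases hd : P.dueTurn (P.exec X ρ m')
      · have hd' := (P.flag_dueTurn_iff h).2 hd
        obtain ⟨i, b, hl, ht⟩ := hd
        have hne := channel_ne_nil_of_getLast hl
        have e₁ := P.exec_succ_of_inr (P.next_of_turn (X := X) (ρ := ρ) hl ht)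
        obtain ⟨i', b', hl', ht'⟩ := hd'
        rw [h.getLast_eq, hl] at hl'
        simp only [Option.some.injEq, Prod.mk.injEq] at hl'
        obtain ⟨rfl, rfl⟩ := hl'
        have e₂ := P.flag.exec_succ_of_inr
          (P.flag.next_of_turn (X := X) (ρ := ρ) (h.getLast_eq.trans hl) ht')
        refine ⟨m' + 1, Or.inl ?_⟩
        rw [e₁, e₂]
        have : P.flag.player i (ρ.2 i) (X i) (channel i (P.flag.exec X ρ m)) =
            P.player i (ρ.2 i) (X i) (channel i (P.exec X ρ m')) := by
          rw [h.channel_eq, if_neg hne]; rfl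
        rw [this]
        exact h.snoc hne
      · have hd' := fun h' => hd ((P.flag_dueTurn_iff h).1 h')
        have n₁ := P.next_of_not_dueTurn (X := X) (ρ := ρ) hd
        have n₂ : P.flag.next X ρ (P.flag.exec X ρ m) = _ := P.flag.next_of_not_dueTurn hd'
        have n₃ : P.flag.coord ρ.1 (P.flag.exec X ρ m) = Sum.map id (fun e =>
            if channel e.1 (P.flag.exec X ρ m) = [] then (e.1, false) else e)
            (P.coord ρ.1 (P.exec X ρ m')) := by
          rw [← h.unflag_eq]
        rw [n₃] at n₂
        rcases hc : P.coord ρ.1 (P.exec X ρ m') with y | ⟨i, b⟩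
        · rw [hc] at n₂
          refine ⟨m', Or.inl ?_⟩
          rw [P.flag.exec_succ_of_inl n₂]
          exact h
        · rw [hc] at n₁ n₂
          by_cases hi : channel i (P.exec X ρ m') = []
          · have hi' : channel i (P.flag.exec X ρ m) = [] := by rw [h.channel_eq, if_pos hi]
            simp only [Sum.map_inr, hi', if_true] at n₂
            refine ⟨m', Or.inr ⟨P.flag.exec X ρ m, i, b, P.flag.exec_succ_of_inr n₂, h, hi, hd,
              hc⟩⟩
          · have hi' : channel i (P.flag.exec X ρ m) ≠ [] := by
              rw [h.channel_eq, if_neg hi]; simp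
            simp only [Sum.map_inr, hi', if_false] at n₂
            refine ⟨m' + 1, Or.inl ?_⟩
            rw [P.exec_succ_of_inr n₁, P.flag.exec_succ_of_inr n₂]
            exact h.snoc hi
    · obtain ⟨σ₀, i, b, hσ, hrel, hi, n₁, n₂⟩ := P.flag_next_of_pending h
      refine ⟨m' + 1, Or.inl ?_⟩
      rw [P.exec_succ_of_inr n₁, P.flag.exec_succ_of_inr n₂, hσ]
      exact hrel.snoc_snoc hi

theorem exists_ends_of_flag_ends (h : P.flag.Ends X ρ σ y) :
    ∃ τ, P.Ends X ρ τ y ∧ FlagRel τ σ := by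
  obtain ⟨⟨m, rfl⟩, hn⟩ := h
  obtain ⟨m', h | h⟩ := P.exists_flagRel X ρ m
  · refine ⟨_, ⟨⟨m', rfl⟩, ?_⟩, h⟩
    obtain ⟨hd, hc⟩ := P.flag.next_eq_inl_iff.1 hn
    refine P.next_eq_inl_iff.2 ⟨fun h' => hd ((P.flag_dueTurn_iff h).2 h'), ?_⟩
    change Sum.map id _ (P.coord ρ.1 (unflag (P.flag.exec X ρ m))) = _ at hc
    rw [h.unflag_eq] at hc
    rcases hc' : P.coord ρ.1 (P.exec X ρ m') with y' | e
    · rw [hc'] at hc; simpa using hc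
    · rw [hc'] at hc; simp at hc
  · obtain ⟨σ₀, i, b, hσ, hrel, hi, n₁, n₂⟩ := P.flag_next_of_pending h
    rw [n₂] at hn
    simp at hn

theorem flag_cost_le : P.flag.cost ≤ P.cost + k := by
  refine iSup_le fun X => iSup_le fun ρ => iSup_le fun m => ?_
  obtain ⟨m', h⟩ := P.exists_flagRel X ρ m
  have hu : unflag (P.flag.exec X ρ m) = P.exec X ρ m' := by
    rcases h with h | ⟨σ₀, i, b, hσ, hrel, hi, -, -⟩
    · exact h.unflag_eq
    · rw [hσ, unflag_snoc, if_pos, hrel.unflag_eq]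
      rw [hrel.channel_eq, if_pos hi]
  have h₁ := length_le_length_unflag (P.flag.exec X ρ m)
  rw [hu] at h₁
  calc ((P.flag.exec X ρ m).length : ℕ∞) ≤ ((P.exec X ρ m').length + k : ℕ) := by
        exact_mod_cast h₁
    _ ≤ _ := by
        push_cast
        gcongr
        exact P.length_exec_le_cost X ρ m'

theorem EndsRecognizably.flag {P : Protocol k In Out} (hP : P.EndsRecognizably) :
    P.flag.EndsRecognizably := by
  intro i X X' ρ ρ' σ σ' y y' h h' hne hp
  obtain ⟨τ, hτ, hr⟩ := P.exists_ends_of_flag_ends h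
  obtain ⟨τ', hτ', hr'⟩ := P.exists_ends_of_flag_ends h'
  rw [hr.channel_eq] at hne hp ⊢
  rw [hr'.channel_eq] at hp ⊢
  split_ifs at hne hp ⊢ with h₁ h₂
  · simp at hne
  · simp at hne
  · simp at hp
  · rw [List.cons_prefix_cons] at hp
    rw [hP i X X' ρ ρ' τ τ' y y' hτ hτ' h₁ hp.2]

theorem channel_of_flag_ends (h : P.flag.Ends X ρ σ y) (i : Fin k) :
    channel i σ = [] ∨ ∃ u, channel i σ = false :: u := by
  obtain ⟨τ, -, hr⟩ := P.exists_ends_of_flag_ends h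
  rw [hr.channel_eq i]
  split_ifs
  · exact Or.inl rfl
  · exact Or.inr ⟨_, rfl⟩

end Protocol

end Flag

/-! ### Appending a query phase to a protocol -/

section Query

variable {k : ℕ} {In In' Out Out' Msg : Type}

/-- What the coordinator does after it has obtained an output in `Out` from another protocol: it
sends a message to every player, receives a reply of fixed length from each, and answers. -/
structure QueryPhase (k : ℕ) (In Out Out' Msg : Type) where
  len : ℕ
  code : Msg → List Bool
  msg : Out → Fin k → Msg
  reply : Fin k → In → Msg → List Bool
  ans : Out → (Fin k → List Bool) → Out'
  code_ne_nil : ∀ m, code m ≠ []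
  code_prefix : ∀ m m', code m <+: code m' → m = m'
  length_reply : ∀ i x m, (reply i x m).length = len

namespace QueryPhase

variable (S : QueryPhase k In' Out Out' Msg)

/-- A player who has not been contacted before is sent the bit `true` first. -/
def lead (τ : Transcript k) (i : Fin k) : List Bool := if channel i τ = [] then [true] else []

/-- The bits sent to player `i`. -/
def request (τ : Transcript k) (y : Out) (i : Fin k) : List Bool :=
  lead τ i ++ S.code (S.msg y i)

/-- The schedule of the bits that are exchanged with the players in `L`; the bits that the
coordinator sends are given. -/
def script (τ : Transcript k) (y : Out) (L : List (Fin k)) : List (Fin k × Option Bool) :=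
  L.flatMap fun i => (S.request τ y i).map (fun b => (i, some b)) ++ List.replicate S.len (i, none)

/-- What the coordinator does after `tail` has been exchanged. -/
def act (τ : Transcript k) (y : Out) (tail : Transcript k) : Out' ⊕ (Fin k × Bool) :=
  match (S.script τ y (List.finRange k)).drop tail.length with
  | [] => Sum.inl (S.ans y fun i => (channel i tail).drop ((channel i tail).length - S.len))
  -- An entry `none` is a bit of the reply. In an execution player `i` is then due, so the default
  -- `false` is never sent.
  | (i, b) :: _ => Sum.inr (i, b.getD false)

/-- The bits that are exchanged with player `i`. -/
def word (X : Fin k → In') (τ : Transcript k) (y : Out) (i : Fin k) : List Bool :=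
  S.request τ y i ++ S.reply i (X i) (S.msg y i)

/-- The bits that are exchanged with the players in `L`. -/
def exchange (X : Fin k → In') (τ : Transcript k) (y : Out) (L : List (Fin k)) : Transcript k :=
  L.flatMap fun i => (S.word X τ y i).map fun b => (i, b)

theorem length_exchange (X : Fin k → In') (τ : Transcript k) (y : Out) (L : List (Fin k)) :
    (S.exchange X τ y L).length = (S.script τ y L).length := by
  induction L with
  | nil => rfl
  | cons i L ih =>
    simp only [exchange, script, List.flatMap_cons, List.length_append] at ih ⊢
    rw [ih]
    simp [word, S.length_reply]

theorem channel_exchange (X : Fin k → In') (τ : Transcript k) (y : Out) {L : List (Fin k)}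
    (hL : L.Nodup) (i : Fin k) :
    channel i (S.exchange X τ y L) = if i ∈ L then S.word X τ y i else [] := by
  induction L with
  | nil => rfl
  | cons j L ih =>
    rw [List.nodup_cons] at hL
    have : S.exchange X τ y (j :: L) =
        (S.word X τ y j).map (fun b => (j, b)) ++ S.exchange X τ y L := rfl
    rw [this, channel_append, channel_map_mk, ih hL.2]
    by_cases hj : j = i
    · subst hj; simp [hL.1]
    · simp [hj, Ne.symm hj]

end QueryPhase

namespace Protocol

/-- Countability of the outputs makes the case distinction on the coordinator's action a countable
union. -/
theorem measurableSet_of_coord (P : Protocol k In Out) [Countable Out] (τ : Transcript k)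
    {Φ : Out ⊕ (Fin k × Bool) → P.CoordCoins → Prop} (h : ∀ o, MeasurableSet {r | Φ o r}) :
    MeasurableSet {r | Φ (P.coord r τ) r} := by
  have : {r | Φ (P.coord r τ) r} = ⋃ o, {r | P.coord r τ = o} ∩ {r | Φ o r} := by
    ext r; simp
  rw [this]
  exact MeasurableSet.iUnion fun o => (P.measurableSet_coord τ o).inter (h o)

variable (P : Protocol k In Out) (S : QueryPhase k In' Out Out' Msg)

open Classical in
/-- The output of the coordinator after the transcript `τ`, if it gives one. -/
noncomputable def finish (r : P.CoordCoins) (τ : Transcript k) : Option Out :=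
  if P.dueTurn τ then none else (P.coord r τ).getLeft?

theorem finish_eq_some_iff {X : Fin k → In} {ρ : P.Coins} {τ : Transcript k} {y : Out} :
    P.finish ρ.1 τ = some y ↔ P.next X ρ τ = Sum.inl y := by
  rw [P.next_eq_inl_iff, finish]
  split_ifs with h <;> simp [h]

theorem finish_eq_none {X : Fin k → In} {ρ : P.Coins} {τ : Transcript k} {e : Fin k × Bool}
    (h : P.next X ρ τ = Sum.inr e) : P.finish ρ.1 τ = none := by
  rcases h' : P.finish ρ.1 τ with _ | y
  · rfl
  · rw [P.finish_eq_some_iff (X := X), h] at h'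
    simp at h'

/-- The coordinator first runs `P` and then the queries; `τ` is the part of the transcript that is
known to belong to `P`, and the second transcript is the rest. -/
noncomputable def queryCoord (r : P.CoordCoins) :
    Transcript k → Transcript k → Out' ⊕ (Fin k × Bool)
  | τ, [] => (P.coord r τ).elim (fun y => S.act τ y []) Sum.inr
  | τ, e :: σ => (P.finish r τ).elim (queryCoord r (τ ++ [e]) σ) (fun y => S.act τ y (e :: σ))

theorem measurableSet_queryCoord [Countable Out] (σ τ : Transcript k)
    (a : Out' ⊕ (Fin k × Bool)) : MeasurableSet {r | P.queryCoord S r τ σ = a} := by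
  induction σ generalizing τ with
  | nil =>
    exact P.measurableSet_of_coord τ
      (Φ := fun o _ => o.elim (fun y => S.act τ y []) Sum.inr = a) fun o => .const _
  | cons e σ ih =>
    simp only [queryCoord, finish]
    by_cases h : P.dueTurn τ
    · simp only [h, if_true, Option.elim_none]
      exact ih _
    · simp only [h, if_false]
      refine P.measurableSet_of_coord τ (Φ := fun o r => o.getLeft?.elim
        (P.queryCoord S r (τ ++ [e]) σ) (fun y => S.act τ y (e :: σ)) = a) fun o => ?_
      rcases o with y | e'
      · exact .const (S.act τ y (e :: σ) = a)
      · exact ih _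

/-- The bits on the channel of player `i` at the beginning of the query. -/
def IsStart (i : Fin k) (u : List Bool) : Prop :=
  u = [true] ∨ u ≠ [] ∧ ∃ X ρ τ y, P.Ends X ρ τ y ∧ channel i τ = u

/-- Player `i` has received the message `q.1`, and has sent `q.2`. -/
def IsRequest (i : Fin k) (h : List Bool) (q : Msg × List Bool) : Prop :=
  (∃ u, P.IsStart i u ∧ h = u ++ S.code q.1 ++ q.2) ∧ q.2.length < S.len

open Classical in
/-- Run `P`, with inputs translated by `g`, and then the queries. -/
@[reducible] noncomputable def thenQuery [Countable Out] (g : In' → In) : Protocol k In' Out' where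
  CoordCoins := P.CoordCoins
  PlayerCoins := P.PlayerCoins
  coordLaw := P.coordLaw
  playerLaw := P.playerLaw
  playerTurn i h :=
    -- A start inside the history means that `P` is finished on this channel; from then on the
    -- player speaks only to complete a reply.
    if ∃ u, P.IsStart i u ∧ u <+: h then decide (∃ q, P.IsRequest S i h q)
    else P.playerTurn i h
  coord r σ := P.queryCoord S r [] σ
  player i r x h :=
    if hq : ∃ q, P.IsRequest S i h q then
      -- The choice is harmless for flagged protocols: by `IsFlagged.request_unique` the message and
      -- the length of the partial reply do not depend on it.
      (S.reply i x hq.choose.1).getD hq.choose.2.length false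
    else P.player i r (g x) h
  measurableSet_coord σ a := P.measurableSet_queryCoord S σ [] a
  measurableSet_player i x h b := by
    by_cases hq : ∃ q, P.IsRequest S i h q
    · simp only [hq, dif_pos]; exact .const _
    · simp only [hq, dif_neg, not_false_eq_true]; exact P.measurableSet_player i (g x) h b

/-- The protocol ends recognizably, and every conversation begins with the bit `false`. -/
structure IsFlagged : Prop where
  endsRecognizably : P.EndsRecognizably
  channel_eq : ∀ i X ρ τ y, P.Ends X ρ τ y → channel i τ = [] ∨ ∃ u, channel i τ = false :: u

variable {P} {S}

/-- Starts form a prefix code: `[true]` differs in its first bit from every conversation of `P`, and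
nonempty complete conversations are prefix-free because `P` ends recognizably. -/
theorem IsFlagged.start_unique (hP : P.IsFlagged) {i : Fin k} {u u' h : List Bool}
    (hu : P.IsStart i u) (hu' : P.IsStart i u') (hp : u <+: h) (hp' : u' <+: h) : u = u' := by
  have key : ∀ {u u'}, P.IsStart i u → P.IsStart i u' → u <+: u' → u = u' := by
    rintro u u' (rfl | ⟨hne, X, ρ, τ, y, he, rfl⟩) (rfl | ⟨hne', X', ρ', τ', y', he', rfl⟩) hp
    · rfl
    · obtain ⟨v, hv⟩ := hp
      rcases hP.channel_eq i _ _ _ _ he' with h | ⟨w, h⟩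
      · exact absurd h hne'
      · rw [h] at hv; simp at hv
    · rcases hP.channel_eq i _ _ _ _ he with h | ⟨w, h⟩
      · exact absurd h hne
      · rw [h, List.cons_prefix_cons] at hp; simp at hp
    · exact hP.endsRecognizably i X X' ρ ρ' τ τ' y y' he he' hne hp
  rcases List.prefix_or_prefix_of_prefix hp hp' with h | h
  · exact key hu hu' h
  · exact (key hu' hu h).symm

/-- The channel is parsed from the left, first by the prefix code of starts and then by that of
messages. -/
theorem IsFlagged.request_unique (hP : P.IsFlagged) {i : Fin k} {u u' s s' : List Bool}
    {m m' : Msg} (hu : P.IsStart i u) (hu' : P.IsStart i u')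
    (h : u ++ S.code m ++ s <+: u' ++ S.code m' ++ s') : u = u' ∧ m = m' ∧ s <+: s' := by
  have h₁ : u = u' := by
    refine hP.start_unique hu hu' (h := u' ++ S.code m' ++ s') (List.IsPrefix.trans ?_ h) ?_ <;>
    simp [List.append_assoc]
  subst h₁
  rw [List.append_assoc, List.append_assoc, List.prefix_append_right_inj] at h
  have h₂ : m = m' := by
    have a : S.code m <+: S.code m' ++ s' := (List.prefix_append _ _).trans h
    rcases List.prefix_or_prefix_of_prefix a (List.prefix_append (S.code m') s') with h | h
    · exact S.code_prefix _ _ h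
    · exact (S.code_prefix _ _ h).symm
  subst h₂
  exact ⟨rfl, rfl, (List.prefix_append_right_inj _).1 h⟩

/-- A start inside an unfinished conversation would be a proper prefix of the complete one. Hence a
player in the middle of `P` still follows `P`. -/
theorem IsFlagged.no_start_of_append (hP : P.IsFlagged) {X : Fin k → In} {ρ : P.Coins}
    {τ τ' : Transcript k} {y : Out} (he : P.Ends X ρ τ y) {i : Fin k} {b : Bool}
    (hp : channel i τ' ++ [b] <+: channel i τ) :
    ¬ ∃ u, P.IsStart i u ∧ u <+: channel i τ' := by
  rintro ⟨u, hu, hu'⟩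
  have hne : channel i τ ≠ [] := by
    rintro h; rw [h] at hp; simp at hp
  have h₁ := hP.start_unique hu (Or.inr ⟨hne, X, ρ, τ, y, he, rfl⟩)
    ((hu'.trans (List.prefix_append _ _)).trans hp) (List.prefix_refl _)
  rw [h₁] at hu'
  have := hp.length_le
  have := hu'.length_le
  simp only [List.length_append, List.length_singleton] at *
  omega

theorem exists_exec_of_prefix {P : Protocol k In Out} {X : Fin k → In} {ρ : P.Coins}
    {σ : Transcript k} {m : ℕ} (h : σ <+: P.exec X ρ m) : ∃ m' ≤ m, P.exec X ρ m' = σ := by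
  induction m with
  | zero => exact ⟨0, le_rfl, (List.prefix_nil.1 h).symm⟩
  | succ m ih =>
    rcases P.exec_succ_cases X ρ m with ⟨y, -, hm⟩ | ⟨e, -, hm⟩
    · rw [hm] at h
      obtain ⟨m', hm', h⟩ := ih h
      exact ⟨m', by omega, h⟩
    · rw [hm] at h
      rcases List.prefix_concat_iff.1 h with h | h
      · exact ⟨m + 1, le_rfl, by rw [hm, h]⟩
      · obtain ⟨m', hm', h⟩ := ih h
        exact ⟨m', by omega, h⟩

theorem finish_of_prefix {X : Fin k → In} {ρ : P.Coins} {σ : Transcript k} {m : ℕ}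
    (h : σ <+: P.exec X ρ m) (hne : σ ≠ P.exec X ρ m) : P.finish ρ.1 σ = none := by
  obtain ⟨m', hm', rfl⟩ := exists_exec_of_prefix h
  rcases hn : P.next X ρ (P.exec X ρ m') with y | e
  · exact absurd (P.exec_eq_of_inl hn hm').symm hne
  · exact P.finish_eq_none hn

theorem queryCoord_append (r : P.CoordCoins) (σ tail : Transcript k) (τ : Transcript k)
    (h : ∀ σ', σ' <+: σ → σ' ≠ σ → P.finish r (τ ++ σ') = none) :
    P.queryCoord S r τ (σ ++ tail) = P.queryCoord S r (τ ++ σ) tail := by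
  induction σ generalizing τ with
  | nil => simp
  | cons e σ ih =>
    have h₀ := h [] List.nil_prefix (by simp)
    rw [List.append_nil] at h₀
    rw [List.cons_append, queryCoord, h₀, Option.elim_none, ih]
    · simp
    · intro σ' hσ' hne
      have := h (e :: σ') (by simpa using hσ') (by simpa using hne)
      simpa using this

theorem queryCoord_exec (X : Fin k → In) (ρ : P.Coins) (m : ℕ) (tail : Transcript k) :
    P.queryCoord S ρ.1 [] (P.exec X ρ m ++ tail) = P.queryCoord S ρ.1 (P.exec X ρ m) tail := by
  rw [queryCoord_append]
  · simp
  · intro σ' hp hne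
    rw [List.nil_append]
    exact finish_of_prefix hp hne

/-- The coordinator finds the end of `P` by replaying its own coins along the transcript. No proper
prefix of `τ` yields an output, so the scan stops exactly at `τ`. -/
theorem queryCoord_of_ends {X : Fin k → In} {ρ : P.Coins} {τ : Transcript k} {y : Out}
    (h : P.Ends X ρ τ y) (tail : Transcript k) :
    P.queryCoord S ρ.1 [] (τ ++ tail) = S.act τ y tail := by
  obtain ⟨⟨m, rfl⟩, hn⟩ := h
  rw [queryCoord_exec]
  rcases tail with _ | ⟨e, σ⟩
  · rw [queryCoord, (P.next_eq_inl_iff.1 hn).2]; rfl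
  · rw [queryCoord, P.finish_eq_some_iff.2 hn]; rfl

variable [Countable Out] {g : In' → In}

theorem IsFlagged.playerTurn_of_lt (hP : P.IsFlagged) {i : Fin k} {u v w : List Bool} {b : Bool}
    {m : Msg} (hu : P.IsStart i u) (hm : S.code m = v ++ b :: w) :
    (P.thenQuery S g).playerTurn i (u ++ v) = false := by
  have h₁ : ∃ u', P.IsStart i u' ∧ u' <+: u ++ v := ⟨u, hu, List.prefix_append _ _⟩
  simp only [h₁, if_true, decide_eq_false_iff_not]
  rintro ⟨⟨m', s⟩, ⟨u', hu', h⟩, -⟩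
  have h₂ : u' ++ S.code m' ++ s <+: u ++ S.code m ++ [] := by
    rw [← h, hm]; simp
  obtain ⟨rfl, rfl, hs⟩ := hP.request_unique hu' hu h₂
  have := congrArg List.length h
  simp only [hm, List.length_append, List.length_cons] at this
  omega

theorem IsFlagged.playerTurn_of_le (hP : P.IsFlagged) {i : Fin k} {u s : List Bool} {m : Msg}
    (hu : P.IsStart i u) (hs : S.len ≤ s.length) :
    (P.thenQuery S g).playerTurn i (u ++ S.code m ++ s) = false := by
  have h₁ : ∃ u', P.IsStart i u' ∧ u' <+: u ++ S.code m ++ s :=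
    ⟨u, hu, by rw [List.append_assoc]; exact List.prefix_append _ _⟩
  simp only [h₁, if_true, decide_eq_false_iff_not]
  rintro ⟨⟨m', s'⟩, ⟨u', hu', h⟩, hl⟩
  have h₂ : u ++ S.code m ++ s <+: u' ++ S.code m' ++ s' := by rw [h]
  have := (hP.request_unique hu hu' h₂).2.2.length_le
  simp only at hl
  omega

theorem IsFlagged.playerTurn_of_request (hP : P.IsFlagged) {i : Fin k} {u s : List Bool} {m : Msg}
    (hu : P.IsStart i u) (hs : s.length < S.len) :
    (P.thenQuery S g).playerTurn i (u ++ S.code m ++ s) = true ∧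
    ∀ r x, (P.thenQuery S g).player i r x (u ++ S.code m ++ s) =
      (S.reply i x m).getD s.length false := by
  have h₁ : ∃ u', P.IsStart i u' ∧ u' <+: u ++ S.code m ++ s :=
    ⟨u, hu, by rw [List.append_assoc]; exact List.prefix_append _ _⟩
  have h₂ : ∃ q, P.IsRequest S i (u ++ S.code m ++ s) q := ⟨(m, s), ⟨u, hu, rfl⟩, hs⟩
  refine ⟨by simp only [h₁, h₂, if_true, decide_true], fun r x => ?_⟩
  simp only [h₂, dif_pos]
  obtain ⟨⟨u', hu', h⟩, -⟩ := h₂.choose_spec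
  obtain ⟨-, hm, hs'⟩ := hP.request_unique hu hu' (by rw [← h])
  have hs'' := (hP.request_unique hu' hu (by rw [← h])).2.2
  rw [← hm, hs'.length_le.antisymm hs''.length_le]

/-- The combined protocol first reproduces the execution of `P`. -/
theorem IsFlagged.exists_exec_eq (hP : P.IsFlagged) {X : Fin k → In'} {ρ : P.Coins}
    {τ : Transcript k} {y : Out} (he : P.Ends (fun i => g (X i)) ρ τ y) (m : ℕ) :
    ∃ m', (P.thenQuery S g).exec X ρ m' = P.exec (fun i => g (X i)) ρ m := by
  induction m with
  | zero => exact ⟨0, rfl⟩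
  | succ m ih =>
    obtain ⟨m', ih⟩ := ih
    set σ := P.exec (fun i => g (X i)) ρ m with hσ
    rcases P.exec_succ_cases (fun i => g (X i)) ρ m with ⟨y', -, hm⟩ | ⟨e, hn, hm⟩
    · exact ⟨m', by rw [ih, hm]⟩
    refine ⟨m' + 1, ?_⟩
    suffices h : (P.thenQuery S g).next X ρ σ = Sum.inr e by
      rw [(P.thenQuery S g).exec_succ_of_inr (by rw [ih]; exact h), ih, hm]
    rw [← hσ] at hn
    have hp : σ ++ [e] <+: τ := by rw [← hm]; exact he.exec_prefix _
    by_cases hd : P.dueTurn σ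
    · obtain ⟨i, b, hl, ht⟩ := hd
      rw [P.next_of_turn hl ht] at hn
      simp only [Sum.inr.injEq] at hn
      have hns : ¬ ∃ u, P.IsStart i u ∧ u <+: channel i σ := by
        refine hP.no_start_of_append he (b := e.2) ?_
        obtain ⟨v, hv⟩ := hp
        rw [← hv, channel_append, channel_snoc, if_pos (by rw [← hn])]
        exact List.prefix_append _ _
      have hnr : ¬ ∃ q, P.IsRequest S i (channel i σ) q := by
        rintro ⟨q, ⟨u, hu, h⟩, -⟩
        exact hns ⟨u, hu, by rw [h, List.append_assoc]; exact List.prefix_append _ _⟩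
      rw [(P.thenQuery S g).next_of_turn hl]
      · rw [← hn]
        simp only [hnr, dif_neg, not_false_eq_true]
      · simp only [hns, if_false]
        exact ht
    · rw [P.next_of_not_dueTurn hd] at hn
      rw [(P.thenQuery S g).next_of_not_dueTurn]
      · show P.queryCoord S ρ.1 [] σ = _
        have := queryCoord_exec (S := S) (fun i => g (X i)) ρ m []
        rw [← hσ, List.append_nil] at this
        rw [this, queryCoord, hn]
        rfl
      · rintro ⟨i, b, hl, ht⟩
        -- The conversation on channel `i` may already be complete while `P` continues elsewhere. A
        -- request would be strictly longer, since code words are nonempty.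
        have hnr : ¬ ∃ q, P.IsRequest S i (channel i σ) q := by
          rintro ⟨⟨m₀, s₀⟩, ⟨u, hu, h⟩, -⟩
          have hst : channel i τ ≠ [] := by
            obtain ⟨v, hv⟩ := hp
            rw [← hv, channel_append, channel_append]
            simp [channel_ne_nil_of_getLast hl]
          have hp' : channel i σ <+: channel i τ := by
            obtain ⟨v, hv⟩ := hp
            rw [← hv, channel_append, channel_append, List.append_assoc]
            exact List.prefix_append _ _
          have hu' : u <+: channel i τ := by
            refine List.IsPrefix.trans ?_ hp'
            rw [h, List.append_assoc]; exact List.prefix_append _ _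
          have := hP.start_unique hu (Or.inr ⟨hst, _, _, _, _, he, rfl⟩) hu' (List.prefix_refl _)
          have h1 := hp'.length_le
          rw [h, ← this] at h1
          have h2 := List.length_pos_iff.2 (S.code_ne_nil m₀)
          simp only [List.length_append] at h1
          omega
        simp only [hnr, decide_false] at ht
        split_ifs at ht with h
        exact hd ⟨i, b, hl, ht⟩

end Protocol

end Query

/-! ### Execution and cost of the query phase -/

section Exchange

variable {k : ℕ} {In In' Out Out' Msg : Type}

namespace Protocol

variable {P : Protocol k In Out} {S : QueryPhase k In' Out Out' Msg} {ρ : P.Coins}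
  {τ : Transcript k} {y : Out}

theorem Ends.isStart {X : Fin k → In} (he : P.Ends X ρ τ y) (i : Fin k) :
    P.IsStart i (channel i τ ++ QueryPhase.lead τ i) := by
  by_cases h : channel i τ = []
  · left; simp [QueryPhase.lead, h]
  · right
    simp only [QueryPhase.lead, h, if_false, List.append_nil]
    exact ⟨h, X, ρ, τ, y, he, rfl⟩

variable [Countable Out] {g : In' → In} {X : Fin k → In'}

theorem IsFlagged.playerTurn_word (hP : P.IsFlagged) (he : P.Ends (fun i => g (X i)) ρ τ y)
    (i : Fin k) :
    (P.thenQuery S g).playerTurn i (channel i τ ++ S.word X τ y i) = false := by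
  have h : channel i τ ++ S.word X τ y i = (channel i τ ++ QueryPhase.lead τ i) ++
      S.code (S.msg y i) ++ S.reply i (X i) (S.msg y i) := by
    simp [QueryPhase.word, QueryPhase.request]
  rw [h]
  exact hP.playerTurn_of_le (he.isStart i) (S.length_reply _ _ _).ge

theorem IsFlagged.playerTurn_request (hP : P.IsFlagged) (he : P.Ends (fun i => g (X i)) ρ τ y)
    (i : Fin k) {w v : List Bool} {b : Bool} (hw : S.request τ y i = w ++ b :: v)
    (hne : channel i τ ++ w ≠ []) :
    (P.thenQuery S g).playerTurn i (channel i τ ++ w) = false := by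
  have hst := he.isStart i
  by_cases h : channel i τ = []
  · simp only [QueryPhase.request, QueryPhase.lead, h, if_true] at hw hst
    rw [h, List.nil_append] at hne ⊢
    rcases w with _ | ⟨c, w⟩
    · exact absurd rfl hne
    · simp only [List.cons_append, List.nil_append, List.cons.injEq] at hw
      obtain ⟨rfl, hw⟩ := hw
      exact hP.playerTurn_of_lt (u := [true]) hst hw
  · simp only [QueryPhase.request, QueryPhase.lead, h, if_false, List.nil_append,
      List.append_nil] at hw hst
    exact hP.playerTurn_of_lt hst hw

/-- While a request is incomplete no player is due, and the coordinator follows its schedule. Once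
it is complete, the last bit lies on channel `i` and the player stays due until its reply has full
length. -/
theorem IsFlagged.next_exchange (hP : P.IsFlagged) (he : P.Ends (fun i => g (X i)) ρ τ y)
    {L₁ L₂ : List (Fin k)} {i : Fin k} (hL : List.finRange k = L₁ ++ i :: L₂)
    {w v : List Bool} {b : Bool} (hw : S.word X τ y i = w ++ b :: v) :
    (P.thenQuery S g).next X ρ (τ ++ (S.exchange X τ y L₁ ++ w.map fun b => (i, b))) =
      Sum.inr (i, b) := by
  have hnd : (L₁ ++ i :: L₂).Nodup := hL ▸ List.nodup_finRange k
  have hi : i ∉ L₁ := by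
    intro h
    exact (List.nodup_append.1 hnd).2.2 i h i (by simp) rfl
  set tail := S.exchange X τ y L₁ ++ w.map fun b => (i, b) with htail
  have hch : ∀ j, channel j (τ ++ tail) =
      channel j τ ++ ((if j ∈ L₁ then S.word X τ y j else []) ++ if i = j then w else []) := by
    intro j
    rw [htail, channel_append, channel_append, channel_map_mk,
      S.channel_exchange X τ y (List.nodup_append.1 hnd).1]
  have hchi : channel i (τ ++ tail) = channel i τ ++ w := by rw [hch]; simp [hi]
  rcases lt_or_ge w.length (S.request τ y i).length with hlt | hge
  · obtain ⟨v', hv'⟩ : ∃ v', S.request τ y i = w ++ b :: v' := by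
      have hp : w ++ [b] <+: S.request τ y i := by
        refine List.prefix_of_prefix_length_le (l₃ := S.word X τ y i) ?_
          (List.prefix_append _ _) (by simpa using hlt)
        rw [hw]; exact ⟨v, by simp⟩
      obtain ⟨v', hv'⟩ := hp
      exact ⟨v', by rw [← hv']; simp⟩
    rw [(P.thenQuery S g).next_of_not_dueTurn]
    · show P.queryCoord S ρ.1 [] (τ ++ tail) = _
      rw [queryCoord_of_ends he, QueryPhase.act, hL]
      have hs : (S.script τ y (L₁ ++ i :: L₂)).drop tail.length =
          (i, some b) :: (v'.map (fun b => (i, some b)) ++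
            List.replicate S.len (i, none) ++ S.script τ y L₂) := by
        have e₁ : S.script τ y (L₁ ++ i :: L₂) =
            (S.script τ y L₁ ++ w.map fun b => (i, some b)) ++
              ((i, some b) :: (v'.map (fun b => (i, some b)) ++
                List.replicate S.len (i, none) ++ S.script τ y L₂)) := by
          simp [QueryPhase.script, hv']
        rw [e₁]
        refine List.drop_left' ?_
        simp [htail, S.length_exchange]
      rw [hs]
      rfl
    · rintro ⟨j, c, hl, ht⟩
      have hne := channel_ne_nil_of_getLast hl
      by_cases hj : j ∈ L₁
      · have hij : i ≠ j := fun h => hi (h ▸ hj)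
        have hj' : channel j (τ ++ tail) = channel j τ ++ S.word X τ y j := by
          rw [hch]; simp [hj, hij]
        rw [hj', hP.playerTurn_word he] at ht
        exact absurd ht (by decide)
      · by_cases hij : i = j
        · subst hij
          rw [hchi] at hne
          rw [hchi, hP.playerTurn_request he i hv' hne] at ht
          exact absurd ht (by decide)
        -- Channel `j` carries only its complete conversation under `P`, after which the coordinator
        -- has to send the request.
        · have hj' : channel j (τ ++ tail) = channel j τ := by
            rw [hch]; simp [hj, hij]
          rw [hj'] at hne
          have hr : S.request τ y j ≠ [] := by
            simp [QueryPhase.request, S.code_ne_nil]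
          obtain ⟨b', v'', hb⟩ := List.exists_cons_of_ne_nil hr
          have := hP.playerTurn_request he j (w := []) (by simpa using hb) (by simpa using hne)
          rw [List.append_nil] at this
          rw [hj', this] at ht
          exact absurd ht (by decide)
  · obtain ⟨s, hs⟩ : ∃ s, w = S.request τ y i ++ s := by
      have hp : S.request τ y i <+: w :=
        List.prefix_of_prefix_length_le (l₃ := S.word X τ y i) (List.prefix_append _ _)
          (by rw [hw]; exact List.prefix_append _ _) hge
      obtain ⟨s, hs⟩ := hp
      exact ⟨s, hs.symm⟩
    have hrep : S.reply i (X i) (S.msg y i) = s ++ b :: v := by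
      have := hw
      rw [QueryPhase.word, hs, List.append_assoc] at this
      exact List.append_cancel_left this
    have hslen : s.length < S.len := by
      rw [← S.length_reply i (X i) (S.msg y i), hrep]; simp
    have hsplit : channel i (τ ++ tail) =
        (channel i τ ++ QueryPhase.lead τ i) ++ S.code (S.msg y i) ++ s := by
      rw [hchi, hs, QueryPhase.request]; simp
    obtain ⟨ht, hpl⟩ := hP.playerTurn_of_request (S := S) (g := g) (m := S.msg y i)
      (he.isStart i) hslen
    rw [← hsplit] at ht hpl
    have hwne : w ≠ [] := by
      rw [hs]; simp [QueryPhase.request, S.code_ne_nil]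
    obtain ⟨c, hl⟩ : ∃ c, (τ ++ tail).getLast? = some (i, c) := by
      obtain ⟨w', c, hc⟩ := List.eq_nil_or_concat w |>.resolve_left hwne
      refine ⟨c, ?_⟩
      rw [htail, hc]
      simp
    rw [(P.thenQuery S g).next_of_turn hl ht, hpl, hrep]
    simp

theorem IsFlagged.ends_exchange (hP : P.IsFlagged) (he : P.Ends (fun i => g (X i)) ρ τ y) :
    (P.thenQuery S g).Ends X ρ (τ ++ S.exchange X τ y (List.finRange k))
      (S.ans y fun i => S.reply i (X i) (S.msg y i)) := by
  have hword : ∀ {L₁ L₂ : List (Fin k)} {i : Fin k}, List.finRange k = L₁ ++ i :: L₂ →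
      (∃ m, (P.thenQuery S g).exec X ρ m = τ ++ S.exchange X τ y L₁) →
      ∀ w v, S.word X τ y i = w ++ v → ∃ m, (P.thenQuery S g).exec X ρ m =
        τ ++ (S.exchange X τ y L₁ ++ w.map fun b => (i, b)) := by
    intro L₁ L₂ i hL hm w
    induction w using List.reverseRecOn with
    | nil => intro v _; simpa using hm
    | append_singleton w b ih =>
      intro v hv
      obtain ⟨m, hm'⟩ := ih (b :: v) (by rw [hv]; simp)
      refine ⟨m + 1, ?_⟩
      have hn := hP.next_exchange (S := S) he hL (w := w) (b := b) (v := v) (by rw [hv]; simp)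
      rw [(P.thenQuery S g).exec_succ_of_inr (by rw [hm']; exact hn), hm']
      simp
  have hlist : ∀ L₁ L₂ : List (Fin k), List.finRange k = L₁ ++ L₂ →
      ∃ m, (P.thenQuery S g).exec X ρ m = τ ++ S.exchange X τ y L₁ := by
    intro L₁
    induction L₁ using List.reverseRecOn with
    | nil =>
      intro _ _
      obtain ⟨m, hm⟩ := he.1
      obtain ⟨m', hm'⟩ := hP.exists_exec_eq (S := S) he m
      exact ⟨m', by rw [hm', hm]; simp [QueryPhase.exchange]⟩
    | append_singleton L i ih =>
      intro L₂ hL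
      rw [List.append_assoc, List.singleton_append] at hL
      obtain ⟨m, hm⟩ := hword hL (ih _ hL) _ [] (List.append_nil _).symm
      exact ⟨m, by rw [hm]; simp [QueryPhase.exchange]⟩
  refine ⟨hlist _ [] (List.append_nil _).symm, ?_⟩
  have hch : ∀ j, channel j (S.exchange X τ y (List.finRange k)) = S.word X τ y j := by
    intro j
    rw [S.channel_exchange X τ y (List.nodup_finRange k), if_pos (List.mem_finRange j)]
  rw [(P.thenQuery S g).next_of_not_dueTurn]
  · show P.queryCoord S ρ.1 [] _ = _
    rw [queryCoord_of_ends he, QueryPhase.act, S.length_exchange, List.drop_length]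
    simp only [hch, Sum.inl.injEq]
    congr 1
    funext j
    rw [QueryPhase.word]
    refine List.drop_left' ?_
    rw [List.length_append, S.length_reply]
    omega
  · rintro ⟨j, c, hl, ht⟩
    rw [channel_append, hch, hP.playerTurn_word he] at ht
    exact absurd ht (by decide)

variable {C B : ℕ}

theorem IsFlagged.ends_thenQuery (hP : P.IsFlagged) (hC : P.cost ≤ C) {σ : Transcript k}
    {y' : Out'} (h : (P.thenQuery S g).Ends X ρ σ y') :
    ∃ τ y, P.Ends (fun i => g (X i)) ρ τ y ∧
      σ = τ ++ S.exchange X τ y (List.finRange k) := by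
  obtain ⟨y, he⟩ := P.exists_ends hC (fun i => g (X i)) ρ
  exact ⟨_, y, he, (h.unique (hP.ends_exchange he)).1⟩

/-- Every channel now carries a start, a code word and a reply of fixed length, and such words are
prefix-free. -/
theorem IsFlagged.endsRecognizably_thenQuery (hP : P.IsFlagged) (hC : P.cost ≤ C) :
    (P.thenQuery S g).EndsRecognizably := by
  intro i X X' ρ ρ' σ σ' y y' h h' _ hp
  obtain ⟨τ, z, he, rfl⟩ := hP.ends_thenQuery hC h
  obtain ⟨τ', z', he', rfl⟩ := hP.ends_thenQuery hC h'
  have key : ∀ {X : Fin k → In'} {τ z}, channel i (τ ++ S.exchange X τ z (List.finRange k)) =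
      (channel i τ ++ QueryPhase.lead τ i) ++ S.code (S.msg z i) ++
        S.reply i (X i) (S.msg z i) := by
    intro X τ z
    rw [channel_append, S.channel_exchange X τ z (List.nodup_finRange k),
      if_pos (List.mem_finRange i), QueryPhase.word, QueryPhase.request]
    simp
  rw [key, key] at hp ⊢
  obtain ⟨h₁, h₂, h₃⟩ := hP.request_unique (he.isStart i) (he'.isStart i) hp
  rw [h₁, h₃.eq_of_length (by rw [S.length_reply, S.length_reply]), h₂]

theorem IsFlagged.cost_thenQuery_le (hP : P.IsFlagged) (hC : P.cost ≤ C)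
    (hB : ∀ y, ∑ i, (S.code (S.msg y i)).length ≤ B) :
    (P.thenQuery S g).cost ≤ P.cost + (B + k * (S.len + 1) : ℕ) := by
  refine iSup_le fun X => iSup_le fun ρ => iSup_le fun m => ?_
  obtain ⟨y, he⟩ := P.exists_ends hC (fun i => g (X i)) ρ
  have h₁ := ((hP.ends_exchange (S := S) he).exec_prefix m).length_le
  set τ := P.exec (fun i => g (X i)) ρ (C + 1)
  have h₂ : (S.exchange X τ y (List.finRange k)).length ≤ B + k * (S.len + 1) := by
    rw [← sum_length_channel]
    calc _ ≤ ∑ i, ((S.code (S.msg y i)).length + (S.len + 1)) := by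
          refine Finset.sum_le_sum fun i _ => ?_
          rw [S.channel_exchange X τ y (List.nodup_finRange k), if_pos (List.mem_finRange i),
            QueryPhase.word, QueryPhase.request, List.length_append, List.length_append,
            S.length_reply]
          have : (QueryPhase.lead τ i).length ≤ 1 := by
            unfold QueryPhase.lead; split_ifs <;> simp
          omega
      _ ≤ _ := by
          rw [Finset.sum_add_distrib]
          have := hB y
          simp only [Finset.sum_const, Finset.card_univ, Fintype.card_fin, smul_eq_mul]
          omega
  rw [List.length_append] at h₁
  calc (((P.thenQuery S g).exec X ρ m).length : ℕ∞) ≤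
        (τ.length + (B + k * (S.len + 1)) : ℕ) := by
        exact_mod_cast h₁.trans (by omega)
    _ ≤ _ := by
        push_cast
        gcongr
        exact P.length_exec_le_cost _ _ _

end Protocol

end Exchange

/-! ### Set Disjointness from Task Allocation -/

section Reduction

variable {k n : ℕ}

/-- A prefix code for lists, from one of fixed length for their entries. -/
def listCode {α : Type} (f : α → List Bool) : List α → List Bool
  | [] => [false]
  | j :: l => true :: (f j ++ listCode f l)

theorem listCode_ne_nil {α : Type} (f : α → List Bool) (l : List α) : listCode f l ≠ [] := by
  cases l <;> simp [listCode]

theorem length_listCode {α : Type} {f : α → List Bool} {L : ℕ} (hf : ∀ j, (f j).length = L)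
    (l : List α) : (listCode f l).length = l.length * (L + 1) + 1 := by
  induction l with
  | nil => simp [listCode]
  | cons j l ih => simp [listCode, ih, hf]; ring

/-- The bit in front of each block says whether another entry follows, and the blocks have equal
length. -/
theorem listCode_prefix {α : Type} {f : α → List Bool} {L : ℕ} (hf : ∀ j, (f j).length = L)
    (hinj : Function.Injective f) (l l' : List α) (h : listCode f l <+: listCode f l') :
    l = l' := by
  induction l generalizing l' with
  | nil => cases l' <;> simp [listCode] at h ⊢
  | cons j l ih =>
    rcases l' with _ | ⟨j', l'⟩
    · simp [listCode] at h
    · simp only [listCode, List.cons_prefix_cons, true_and] at h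
      have hj : f j = f j' := by
        have h₁ := (List.prefix_append (f j) _).trans h
        have h₂ := List.prefix_of_prefix_length_le h₁ (List.prefix_append (f j') _)
          (by rw [hf, hf])
        exact h₂.eq_of_length (by rw [hf, hf])
      rw [hj, List.prefix_append_right_inj] at h
      rw [hinj hj, ih l' h]

theorem exists_fixed_length_code (n : ℕ) :
    ∃ f : Fin n → List Bool, Function.Injective f ∧ ∀ j, (f j).length = Nat.clog 2 n := by
  have hcard : Fintype.card (Fin n) ≤ Fintype.card (Fin (Nat.clog 2 n) → Bool) := by
    simpa using Nat.le_pow_clog (by norm_num) n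
  obtain ⟨e⟩ := Function.Embedding.nonempty_of_card_le hcard
  exact ⟨fun j => List.ofFn (e j), fun j j' h => e.injective (List.ofFn_injective h),
    fun j => by simp⟩

open Classical in
/-- Ask every player whether none of the tasks assigned to it belongs to its input. -/
noncomputable def verifyPhase (f : Fin n → List Bool) {L : ℕ} (hf : ∀ j, (f j).length = L)
    (hinj : Function.Injective f) :
    QueryPhase k (Finset (Fin n)) (Fin n → Fin k) Bool (List (Fin n)) where
  len := 1
  code := listCode f
  msg Y i := (Finset.univ.filter fun j => Y j = i).toList
  reply _ x l := [decide (∀ j ∈ l, j ∉ x)]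
  ans _ R := decide (∃ i, R i = [false])
  code_ne_nil := listCode_ne_nil f
  code_prefix := listCode_prefix hf hinj
  length_reply _ _ _ := rfl

/-- The lists sent to the players partition the `n` tasks; each list costs one more bit to mark its
end. -/
theorem sum_length_verifyPhase {f : Fin n → List Bool} {L : ℕ} (hf : ∀ j, (f j).length = L)
    (hinj : Function.Injective f) (Y : Fin n → Fin k) :
    ∑ i, ((verifyPhase (k := k) f hf hinj).code ((verifyPhase f hf hinj).msg Y i)).length ≤
      n * (L + 1) + k := by
  have h : ∀ i : Fin k,
      ((verifyPhase (k := k) f hf hinj).code ((verifyPhase f hf hinj).msg Y i)).length =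
      (Finset.univ.filter fun j => Y j = i).card * (L + 1) + 1 := fun i => by
    simp [verifyPhase, length_listCode hf]
  simp only [h, Finset.sum_add_distrib, ← Finset.sum_mul]
  have hc : ∑ i : Fin k, (Finset.univ.filter fun j => Y j = i).card = n := by
    rw [← Finset.card_eq_sum_card_fiberwise (fun _ _ => Finset.mem_coe.2 (Finset.mem_univ _))]
    simp
  rw [hc]
  simp

theorem verifyPhase_ans (f : Fin n → List Bool) {L : ℕ} (hf : ∀ j, (f j).length = L)
    (hinj : Function.Injective f) (X : Fin k → Finset (Fin n)) (Y : Fin n → Fin k) :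
    (verifyPhase f hf hinj).ans Y
      (fun i => (verifyPhase f hf hinj).reply i (X i) ((verifyPhase f hf hinj).msg Y i)) = true ↔
      ∃ j, j ∈ X (Y j) := by
  simp only [verifyPhase, decide_eq_true_eq, List.cons.injEq, and_true, decide_eq_false_iff_not,
    Finset.mem_toList, Finset.mem_filter, Finset.mem_univ, true_and, not_forall, not_not]
  constructor
  · rintro ⟨i, j, rfl, hj⟩
    exact ⟨j, hj⟩
  · rintro ⟨j, hj⟩
    exact ⟨Y j, j, rfl, hj⟩

open Classical in
/-- Ask every player for its input. -/
noncomputable def collectPhase (k n : ℕ) :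
    QueryPhase k (Finset (Fin n)) Unit Bool Unit where
  len := n
  code _ := [true]
  msg _ _ := ()
  reply _ x _ := List.ofFn fun j => decide (j ∈ x)
  ans _ R := decide (∃ j : Fin n, ∀ i, (R i)[(j : ℕ)]? = some true)
  code_ne_nil _ := by simp
  code_prefix _ _ _ := rfl
  length_reply _ _ _ := by simp

/-- The protocol without communication. -/
@[reducible] noncomputable def silent (k : ℕ) (In : Type) : Protocol k In Unit where
  CoordCoins := Unit
  PlayerCoins _ := Unit
  coordLaw := Measure.dirac ()
  playerLaw _ := Measure.dirac ()
  playerTurn _ _ := false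
  coord _ _ := Sum.inl ()
  player _ _ _ _ := false
  measurableSet_coord _ _ := .const _
  measurableSet_player _ _ _ _ := .const _

theorem silent_next (k : ℕ) (In : Type) (X : Fin k → In) (ρ : (silent k In).Coins)
    (τ : Transcript k) : (silent k In).next X ρ τ = Sum.inl () :=
  ((silent k In).next_eq_inl_iff).2 ⟨fun ⟨_, _, _, h⟩ => Bool.false_ne_true h, rfl⟩

theorem silent_exec (k : ℕ) (In : Type) (X : Fin k → In) (ρ : (silent k In).Coins) (m : ℕ) :
    (silent k In).exec X ρ m = [] :=
  (silent k In).exec_eq_of_inl (m := 0) (silent_next k In X ρ _) (Nat.zero_le m)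

theorem silent_isFlagged (k : ℕ) (In : Type) : (silent k In).IsFlagged where
  endsRecognizably i X X' ρ ρ' τ τ' y y' h _ hne _ := by
    obtain ⟨⟨m, rfl⟩, -⟩ := h
    rw [silent_exec] at hne
    exact absurd rfl hne
  channel_eq i X ρ τ y h := by
    obtain ⟨⟨m, rfl⟩, -⟩ := h
    left
    rw [silent_exec]
    rfl

theorem silent_cost (k : ℕ) (In : Type) : (silent k In).cost ≤ (0 : ℕ) :=
  iSup_le fun X => iSup_le fun ρ => iSup_le fun m => by rw [silent_exec]; simp

/-- Collecting all inputs is always correct. This suffices when the given protocol has infinite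
cost. -/
theorem exists_recognizable_setDisjointness (n k : ℕ) {δ : ℝ} :
    ∃ Q : Protocol k (Finset (Fin n)) Bool,
      Q.EndsRecognizably ∧ Q.Solves (setDisjointness n k) δ := by
  have hP := silent_isFlagged k (Finset (Fin n))
  refine ⟨(silent k (Finset (Fin n))).thenQuery (collectPhase k n) id,
    hP.endsRecognizably_thenQuery (silent_cost _ _), fun X _ => ?_⟩
  refine le_trans ?_ (zero_le (a := ENNReal.ofReal δ))
  rw [← measure_empty (μ := ((silent k (Finset (Fin n))).thenQuery
    (collectPhase k n) id).law)]
  refine measure_mono fun ρ hρ => hρ ?_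
  obtain ⟨y, he⟩ := (silent k (Finset (Fin n))).exists_ends (silent_cost k _)
    (fun i => id (X i)) ρ
  refine ⟨_, _, hP.ends_exchange (S := collectPhase k n) he, ?_⟩
  simp [setDisjointness, collectPhase]

theorem isFlagged_flag {In Out : Type} {P : Protocol k In Out} (hP : P.EndsRecognizably) :
    P.flag.IsFlagged :=
  ⟨hP.flag, fun i _ _ _ _ h => P.channel_of_flag_ends h i⟩

/-- The error is one-sided. A common element lies in the set of whichever player it is assigned to,
so it is detected even if the promise fails for the complements; without one, an error requires an
incorrect assignment by `P`. -/
theorem solves_setDisjointness {δ : ℝ}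
    {P : Protocol k (Finset (Fin n)) (Fin n → Fin k)} (hP : P.EndsRecognizably)
    (hsol : P.Solves (taskAllocation n k) δ) {C : ℕ} (hC : P.flag.cost ≤ C)
    {f : Fin n → List Bool} {L : ℕ} (hf : ∀ j, (f j).length = L)
    (hinj : Function.Injective f) :
    (P.flag.thenQuery (verifyPhase f hf hinj) fun x => xᶜ).Solves (setDisjointness n k) δ := by
  intro X _
  have hend : ∀ ρ : P.Coins, ∃ τ y, P.Ends (fun i => (X i)ᶜ) ρ τ y ∧
      ∃ σ, (P.flag.thenQuery (verifyPhase f hf hinj) fun x => xᶜ).Ends X ρ σ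
        ((verifyPhase f hf hinj).ans y fun i =>
          (verifyPhase f hf hinj).reply i (X i) ((verifyPhase f hf hinj).msg y i)) := by
    intro ρ
    obtain ⟨y, he⟩ := P.flag.exists_ends hC (fun i => (X i)ᶜ) ρ
    obtain ⟨τ, hτ, -⟩ := P.exists_ends_of_flag_ends he
    exact ⟨τ, y, hτ, _, (isFlagged_flag hP).ends_exchange he⟩
  by_cases hX : ∃ j, ∀ i, j ∈ X i
  · refine le_trans ?_ (zero_le (a := ENNReal.ofReal δ))
    rw [← measure_empty (μ := P.law)]
    refine measure_mono fun ρ hρ => hρ ?_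
    obtain ⟨τ, y, -, σ, hσ⟩ := hend ρ
    refine ⟨σ, _, hσ, ?_⟩
    obtain ⟨j, hj⟩ := hX
    exact ⟨fun _ => ⟨j, hj⟩, fun _ => (verifyPhase_ans f hf hinj X y).2 ⟨j, hj _⟩⟩
  · have hprom : (taskAllocation n k).promise fun i => (X i)ᶜ := by
      intro j
      by_contra h
      refine hX ⟨j, fun i => ?_⟩
      by_contra hi
      exact h ⟨i, Finset.mem_compl.2 hi⟩
    refine le_trans (measure_mono fun ρ hρ => ?_) (hsol _ hprom)
    rintro ⟨τ', y', he', hy'⟩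
    refine hρ ?_
    obtain ⟨τ, y, hτ, σ, hσ⟩ := hend ρ
    obtain ⟨-, rfl⟩ := hτ.unique he'
    refine ⟨σ, _, hσ, ?_⟩
    refine (verifyPhase_ans f hf hinj X y).trans ⟨?_, fun h => absurd h hX⟩
    rintro ⟨j, hj⟩
    exact absurd hj (Finset.mem_compl.1 (hy' j))

/-- For `n = 1` the logarithm vanishes and the term `n` has to be absorbed by `k`, which must then
be positive. -/
theorem clog_bound (n k : ℕ) (h : n = 0 ∨ 0 < k) :
    ((n * (Nat.clog 2 n + 1) + 4 * k : ℕ) : ℝ) ≤ 10 * ((n : ℝ) * Real.log n + k) := by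
  push_cast
  have hk : (0 : ℝ) ≤ k := Nat.cast_nonneg k
  rcases Nat.lt_or_ge n 2 with hn | hn
  · interval_cases n
    · simp; linarith
    · have : (1 : ℝ) ≤ k := by
        have : 0 < k := h.resolve_left (by norm_num)
        exact_mod_cast this
      simp; linarith
  · have hn0 : (0 : ℝ) < n := by positivity
    have hl2 := Real.log_two_gt_d9
    have hlog : Real.log 2 ≤ Real.log n :=
      Real.log_le_log (by norm_num) (by exact_mod_cast hn)
    have hL : ((Nat.clog 2 n : ℕ) : ℝ) * Real.log 2 ≤ Real.log n + Real.log 2 := by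
      have h1 : 1 ≤ Nat.clog 2 n := Nat.clog_pos (by norm_num) hn
      have h2 : 2 ^ (Nat.clog 2 n).pred < n := Nat.pow_pred_clog_lt_self (by norm_num) hn
      have h3 : ((Nat.clog 2 n).pred : ℝ) * Real.log 2 ≤ Real.log n := by
        rw [← Real.log_pow]
        exact Real.log_le_log (by positivity) (by exact_mod_cast h2.le)
      have h4 : ((Nat.clog 2 n : ℕ) : ℝ) = ((Nat.clog 2 n).pred : ℝ) + 1 := by
        exact_mod_cast (Nat.succ_pred_eq_of_pos h1).symm
      rw [h4]; linarith
    have h5 : ((Nat.clog 2 n : ℕ) : ℝ) + 1 ≤ 10 * Real.log n := by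
      have h6 : (0 : ℝ) ≤ (Nat.clog 2 n : ℕ) := Nat.cast_nonneg _
      nlinarith
    nlinarith [mul_le_mul_of_nonneg_left h5 hn0.le]

/-- Without players and with a task there is neither an answer nor a bit to send, yet the coin space
is nonempty and the coordinator must act. -/
theorem eq_zero_or_pos_of_protocol {In : Type} (P : Protocol k In (Fin n → Fin k)) :
    n = 0 ∨ 0 < k := by
  rcases Nat.eq_zero_or_pos k with rfl | hk
  · left
    by_contra hn
    obtain ⟨r⟩ : Nonempty P.CoordCoins := P.coordLaw.nonempty_of_neZero
    rcases P.coord r [] with Y | e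
    · exact (Y ⟨0, Nat.pos_of_ne_zero hn⟩).elim0
    · exact e.1.elim0
  · exact Or.inr hk

theorem exists_setDisjointness_protocol :
    ∃ K : ℝ, 0 < K ∧
      ∀ (n k : ℕ) (δ : ℝ), 0 ≤ δ →
        ∀ P : Protocol k (Finset (Fin n)) (Fin n → Fin k),
          P.EndsRecognizably → P.Solves (taskAllocation n k) δ →
          ∃ Q : Protocol k (Finset (Fin n)) Bool,
            Q.EndsRecognizably ∧ Q.Solves (setDisjointness n k) δ ∧
            (Q.cost : ℝ≥0∞) ≤
              (P.cost : ℝ≥0∞) + ENNReal.ofReal (K * ((n : ℝ) * Real.log n + k)) := by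
  refine ⟨10, by norm_num, fun n k δ _ P hP hsol => ?_⟩
  by_cases htop : P.cost = ⊤
  · obtain ⟨Q, hQ, hQ'⟩ := exists_recognizable_setDisjointness n k (δ := δ)
    exact ⟨Q, hQ, hQ', by simp [htop]⟩
  obtain ⟨C, hC⟩ := ENat.ne_top_iff_exists.1 htop
  have hflag : P.flag.cost ≤ ((C + k : ℕ) : ℕ∞) := by
    refine P.flag_cost_le.trans ?_
    rw [← hC]; push_cast; exact le_rfl
  obtain ⟨f, hinj, hf⟩ := exists_fixed_length_code n
  refine ⟨P.flag.thenQuery (verifyPhase f hf hinj) fun x => xᶜ,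
    (isFlagged_flag hP).endsRecognizably_thenQuery hflag,
    solves_setDisjointness hP hsol hflag hf hinj, ?_⟩
  -- The four extra bits per player are the flag, the leading bit of a first contact, the end mark
  -- of the list, and the reply.
  have h₁ : (P.flag.thenQuery (verifyPhase f hf hinj) fun x => xᶜ).cost ≤
      P.cost + (n * (Nat.clog 2 n + 1) + 4 * k : ℕ) := by
    refine ((isFlagged_flag hP).cost_thenQuery_le hflag
      (sum_length_verifyPhase hf hinj)).trans ?_
    refine (add_le_add_left hflag _).trans ?_
    rw [← hC]
    have : (verifyPhase (k := k) f hf hinj).len = 1 := rfl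
    rw [this]
    norm_cast
    omega
  calc _ ≤ ((P.cost + (n * (Nat.clog 2 n + 1) + 4 * k : ℕ) : ℕ∞) : ℝ≥0∞) := by
        exact_mod_cast h₁
    _ = (P.cost : ℝ≥0∞) + ENNReal.ofReal ((n * (Nat.clog 2 n + 1) + 4 * k : ℕ) : ℝ) := by
        rw [ENNReal.ofReal_natCast]
        push_cast
        rfl
    _ ≤ _ := by
        gcongr
        exact clog_bound n k (eq_zero_or_pos_of_protocol P)

end Reduction

end Coordinator

theorem mainTheorem6 :
    (∃ K : ℝ, 0 < K ∧
      ∀ (n k : ℕ) (δ : ℝ), 0 ≤ δ →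
        ∀ P : Coordinator.Protocol k (Finset (Fin n)) (Fin n → Fin k),
          P.EndsRecognizably → P.Solves (Coordinator.taskAllocation n k) δ →
          ∃ Q : Coordinator.Protocol k (Finset (Fin n)) Bool,
            Q.EndsRecognizably ∧ Q.Solves (Coordinator.setDisjointness n k) δ ∧
            (Q.cost : ℝ≥0∞) ≤
              (P.cost : ℝ≥0∞) + ENNReal.ofReal (K * ((n : ℝ) * Real.log n + k))) ∧
    (∀ δ : ℝ, 0 ≤ δ → δ < 1 →
      ∃ c : ℝ, 0 < c ∧ ∃ a₀ : ℝ, 0 < a₀ ∧ ∃ n₀ : ℕ,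
        ∀ a : ℝ, a₀ ≤ a → ∀ n : ℕ, n₀ ≤ n → ∀ k : ℕ, a * Real.log n ≤ (k : ℝ) →
          ENNReal.ofReal (c * ((n : ℝ) * k)) ≤
            ((Coordinator.taskAllocation n k).cc δ : ℝ≥0∞)) := by
  exact ⟨Coordinator.exists_setDisjointness_protocol, Coordinator.taskAllocation_lower_bound⟩
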